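/- **Setting.** Let $\mathbb{A}=\mathbb{N}$ be the set of names, $\mathrm{Perm}(\mathbb{A})$ the group of permutations of $\mathbb{A}$ moving finitely many names, and $2=\{0,1\}$. For an element $x$ of a $\mathrm{Perm}(\mathbb{A})$-set, $A\subseteq\mathbb{A}$ is a *support* of $x$ if every $\pi$ fixing $A$ pointwise satisfies $\pi x=x$; for a name $a$, write $a\mathbin{\#}x$ if $x$ has a finite support not containing $a$. A *01-substitution set* is a $\mathrm{Perm}(\mathbb{A})$-set $X$ all of whose elements have a finite support, with an equivariant operation $(x,a,i)\mapsto x(a:=i)$, $X\times\mathbb{A}\times 2\to X$, such that $a\mathbin{\#}x(a:=i)$; if $a\mathbin{\#}x$ then $x(a:=i)=x$; and $x(a:=i)(a':=i')=x(a':=i')(a:=i)$ for $a\ne a'$. With the equivariant maps that preserve substitution these form the category $\mathsf{01Sub}$; fibre products in it are formed on underlying sets. *Open boxes.* Let $f:X\to Y$ in $\mathsf{01Sub}$, $A\subseteq\mathbb{A}$ finite, $a\in A$ and $e\in 2$. An *$e$-open $(A,a)$-box over $f$* is a pair $(u,y)$ with $y\in Y$ and $u:(A\times 2)\setminus\{(a,e)\}\to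 X$ such that, for all $(b,i),(b',i')$ in the domain, $b\mathbin{\#}u(b,i)$; $u(b,i)(b':=i')=u(b',i')(b:=i)$ if $b\neq b'$; and $f(u(b,i))=y(b:=i)$. A *filler* is an $x\in X$ with $f(x)=y$ and $x(b:=i)=u(b,i)$ on the domain of $u$. The map $f$ is a *Kan fibration* if for each $e\in 2$ one can choose a filler of every $e$-open box so that the choice commutes with permutations and, for $(A,a)$-boxes, with the componentwise substitutions $(c:=i)$ for $c\notin A$. *The factorisation $X\xrightarrow{\lambda_f}Kf\xrightarrow{\rho_f}Y$.* Put $K_0f=X$, $\rho_0=f$. Given $\rho_n:K_nf\to Y$, let $K_{n+1}f$ be the disjoint union of $X$ and, for each $e\in 2$, of the set of $e$-open boxes $(u,y)$ over $\rho_n$ and of the set of classes $\langle a\rangle(u,y)$ of $e$-open $(A,a)$-boxes over $\rho_n$ in the name abstraction, that is, up to renaming $a$ to a fresh name. There is an evident map $K_nf\to K_{n+1}f$: for $n=0$ it is the inclusion of $X$, and for $n\ge 1$ it is the identity on $X$ and applies $K_{n-1}f\to K_nf$ to the values of $u$. Substitution on $K_{n+1}f$ is that of $X$ on $X$; for an $e$-open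 $(A,a)$-box, $(u,y)(c:=i)$ is the image of $u(c,i)$ if $(c,i)\in(A\times2)\setminus\{(a,e)\}$, is $\langle a\rangle(u,y)$ if $(c,i)=(a,e)$, and is the box $(u(c:=i),y(c:=i))$ if $c\notin A$; and, choosing a representative with $a\neq c$, $(\langle a\rangle(u,y))(c:=i)$ is the image of $u(c,i)(a:=e)$ if $c\in A$, and is $\langle a\rangle(u(c:=i),y(c:=i))$ if $c\notin A$. The map $\rho_{n+1}$ is $f$ on $X$, sends $(u,y)$ to $y$, and sends $\langle a\rangle(u,y)$ to $y(a:=e)$. Then $Kf$ is the colimit of $K_0f\to K_1f\to\cdots$, $\rho_f$ is induced by the $\rho_n$, and $\lambda_f$ is the inclusion of $K_0f=X$. For a Kan fibration $f:X\to Y$ with diagonal $\Delta_f:X\to X\times_YX$, the object $K\Delta_f$, with $\lambda_{\Delta_f}$ and $\rho_{\Delta_f}$, is the path object on $f$ given by this factorisation. *The nerve.* For a metric space $M$, $N(M)$ is the set of uniformly continuous $F:[0,1]^{\mathbb{N}}\to M$ (product metric) that have a finite support for the action $(\pi\cdot F)(r)=F(r\circ\pi)$, with $F(a:=i)(r)=F(r')$,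 where $r'(a)=i$ and $r'(b)=r(b)$ for $b\ne a$. **Theorem.** The path objects $K\Delta_f$ are not stable under pullback. Precisely, let $X=Y=N([0,1])$, let $f:X\to Y$ be the identity, let $Z=1$ be the one-point 01-substitution set, and let $g:1\to N([0,1])$ be the map that picks the constant function $0$. Write $g^*(f):g^*(X)\to 1$ for the pullback of $f$ along $g$. Then $f$ is a Kan fibration, and there is no map $K\Delta_{g^*(f)}\to K\Delta_f$ in $\mathsf{01Sub}$ making the square $$\begin{array}{ccc}K\Delta_{g^*(f)}&\longrightarrow&K\Delta_f\\ {\scriptstyle\rho_{\Delta_{g^*(f)}}}\big\downarrow&&\big\downarrow{\scriptstyle\rho_{\Delta_f}}\\ g^*(X)\times_Zg^*(X)&\longrightarrow&X\times_YX\end{array}$$ a pullback, where the lower map is the canonical one. -/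

import Mathlib

open CategoryTheory
open scoped Pointwise

universe v

set_option linter.unusedSectionVars false

/-! ### Nominal sets -/

/-- `Perm(𝔸)`: the group of permutations of `𝔸` that move only finitely many names. -/
def FinPerm (𝔸 : Type) : Subgroup (Equiv.Perm 𝔸) where
  carrier := {π | {a | π a ≠ a}.Finite}
  one_mem' := by simp
  mul_mem' := by
    intro π σ hπ hσ
    refine (hπ.union hσ).subset ?_
    intro a ha
    by_contra h
    simp only [Set.mem_union, Set.mem_ofPred_eq, not_or, not_not] at h
    exact ha (by simp [Equiv.Perm.mul_apply, h.1, h.2])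
  inv_mem' := by
    intro π hπ
    refine hπ.subset ?_
    intro a ha h
    exact ha (by rw [Equiv.Perm.inv_eq_iff_eq]; exact h.symm)

/-- The transposition `(a b)`. -/
def FinPerm.swap {𝔸 : Type} [DecidableEq 𝔸] (a b : 𝔸) : FinPerm 𝔸 :=
  ⟨Equiv.swap a b, by
    refine (Set.toFinite {a, b}).subset ?_
    intro c hc
    by_contra h
    simp only [Set.mem_insert_iff, Set.mem_singleton_iff, not_or] at h
    exact hc (Equiv.swap_apply_of_ne_of_ne h.1 h.2)⟩

/-- A nominal set: a `Perm(𝔸)`-set all of whose elements have a finite support. -/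
class Nominal (𝔸 : Type) (S : Type v) extends MulAction (FinPerm 𝔸) S where
  exists_support : ∀ x : S, ∃ B : Finset 𝔸, MulAction.Supports (FinPerm 𝔸) (B : Set 𝔸) x

/-- The name `a` is fresh for `x` (`a # x`): some finite support of `x` does not contain `a`. -/
def Fresh {𝔸 : Type} {S : Type v} [MulAction (FinPerm 𝔸) S] (a : 𝔸) (x : S) : Prop :=
  ∃ B : Finset 𝔸, MulAction.Supports (FinPerm 𝔸) (B : Set 𝔸) x ∧ a ∉ B

theorem FinPerm.ext_smul {𝔸 : Type} {π σ : FinPerm 𝔸} (h : ∀ a : 𝔸, π • a = σ • a) : π = σ :=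
  Subtype.ext (Equiv.ext h)

/-- Equivariant functions preserve freshness. -/
theorem Fresh.map {𝔸 : Type} {S T : Type v} [MulAction (FinPerm 𝔸) S] [MulAction (FinPerm 𝔸) T]
    {F : S → T} (hF : ∀ (π : FinPerm 𝔸) (x : S), F (π • x) = π • F x) {a : 𝔸} {x : S}
    (h : Fresh a x) : Fresh a (F x) := by
  obtain ⟨B, hB, ha⟩ := h
  exact ⟨B, fun π hπ => by rw [← hF, hB π hπ], ha⟩

section NominalBasics

variable {𝔸 : Type} [DecidableEq 𝔸] {S : Type v} {T : Type v}

theorem FinPerm.swap_smul (a b c : 𝔸) :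
    FinPerm.swap a b • c = if c = a then b else if c = b then a else c :=
  Equiv.swap_apply_def a b c

theorem Fresh.smul [MulAction (FinPerm 𝔸) S] {a : 𝔸} {x : S} (h : Fresh a x) (π : FinPerm 𝔸) :
    Fresh (π • a) (π • x) := by
  obtain ⟨B, hB, ha⟩ := h
  refine ⟨π • B, ?_, by simpa using ha⟩
  intro σ hσ
  have : (π⁻¹ * σ * π) • x = x := by
    apply hB
    intro b hb
    have := hσ (a := π • b) (by simpa using hb)
    rw [mul_smul, mul_smul, this, inv_smul_smul]
  calc σ • π • x = π • (π⁻¹ * σ * π) • x := by simp [mul_smul]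
    _ = π • x := by rw [this]

theorem Fresh.swap_smul_eq [Infinite 𝔸] [MulAction (FinPerm 𝔸) S] {a c : 𝔸} {x : S}
    (ha : Fresh a x) (hc : Fresh c x) : FinPerm.swap a c • x = x := by
  obtain ⟨B, hB, ha⟩ := ha
  obtain ⟨C, hC, hc⟩ := hc
  by_cases hac : a = c
  · subst hac
    have : FinPerm.swap a a = (1 : FinPerm 𝔸) := Subtype.ext (Equiv.swap_self a)
    rw [this, one_smul]
  obtain ⟨d, hd⟩ := Infinite.exists_notMem_finset (B ∪ C ∪ {a, c})
  simp only [Finset.mem_union, Finset.mem_insert, Finset.mem_singleton, not_or] at hd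
  obtain ⟨⟨hdB, hdC⟩, hda, hdc⟩ := hd
  have h1 : FinPerm.swap a d • x = x := hB _ fun b hb => by
    rw [FinPerm.swap_smul, if_neg, if_neg] <;> rintro rfl <;> simp_all
  have h2 : FinPerm.swap c d • x = x := hC _ fun b hb => by
    rw [FinPerm.swap_smul, if_neg, if_neg] <;> rintro rfl <;> simp_all
  have h3 : FinPerm.swap a c = FinPerm.swap a d * FinPerm.swap c d * FinPerm.swap a d := by
    apply FinPerm.ext_smul
    intro b
    simp only [mul_smul, FinPerm.swap_smul]
    grind
  rw [h3, mul_smul, mul_smul, h1, h2, h1]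

theorem Fresh.of_swap [MulAction (FinPerm 𝔸) S] {a c : 𝔸} {x : S}
    (hc : Fresh c x) (h : FinPerm.swap a c • x = x) : Fresh a x := by
  have := hc.smul (FinPerm.swap a c)
  rw [h, FinPerm.swap_smul] at this
  by_cases hca : c = a
  · exact hca ▸ hc
  · simpa [hca] using this

theorem Fresh.exists_name [Infinite 𝔸] [Nominal 𝔸 S] (x : S) (C : Finset 𝔸) :
    ∃ c, c ∉ C ∧ Fresh c x := by
  obtain ⟨B, hB⟩ := Nominal.exists_support (𝔸 := 𝔸) x
  obtain ⟨c, hc⟩ := Infinite.exists_notMem_finset (B ∪ C)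
  simp only [Finset.mem_union, not_or] at hc
  exact ⟨c, hc.2, B, hB, hc.1⟩

end NominalBasics

/-! ### Name abstraction -/

/-- `α`-equivalence on `𝔸 × S`: `(a, x) ∼ (a', x')` if and only if `(c a) x = (c a') x'`
for some name `c` fresh for `a`, `x`, `a'`, `x'`. -/
def AlphaEquiv {𝔸 : Type} [DecidableEq 𝔸] {S : Type v} [Nominal 𝔸 S] (p q : 𝔸 × S) : Prop :=
  ∃ c : 𝔸, c ≠ p.1 ∧ Fresh c p.2 ∧ c ≠ q.1 ∧ Fresh c q.2 ∧
    FinPerm.swap c p.1 • p.2 = FinPerm.swap c q.1 • q.2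

section Alpha

variable {𝔸 : Type} [DecidableEq 𝔸] [Infinite 𝔸] {S : Type v} [Nominal 𝔸 S]

theorem swap_triple {a c d : 𝔸} {x : S} (hc : Fresh c x) (hd : Fresh d x) (hca : c ≠ a)
    (hda : d ≠ a) : FinPerm.swap d c • FinPerm.swap c a • x = FinPerm.swap d a • x := by
  by_cases hcd : d = c
  · subst hcd
    have : FinPerm.swap d d = (1 : FinPerm 𝔸) := Subtype.ext (Equiv.swap_self d)
    rw [this, one_smul]
  have h : FinPerm.swap d c * FinPerm.swap c a = FinPerm.swap d a * FinPerm.swap d c := by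
    apply FinPerm.ext_smul
    intro b
    simp only [mul_smul, FinPerm.swap_smul]
    grind
  rw [← mul_smul, h, mul_smul, hd.swap_smul_eq hc]

theorem AlphaEquiv.forall_fresh {p q : 𝔸 × S} (h : AlphaEquiv p q) {d : 𝔸} (h1 : d ≠ p.1)
    (h2 : Fresh d p.2) (h3 : d ≠ q.1) (h4 : Fresh d q.2) :
    FinPerm.swap d p.1 • p.2 = FinPerm.swap d q.1 • q.2 := by
  obtain ⟨c, k1, k2, k3, k4, h⟩ := h
  rw [← swap_triple k2 h2 k1 h1, h, swap_triple k4 h4 k3 h3]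

theorem alphaEquiv_swap {a c : 𝔸} {x : S} (hca : c ≠ a) (hc : Fresh c x) :
    AlphaEquiv (a, x) (c, FinPerm.swap c a • x) := by
  obtain ⟨d, hd, hdx⟩ := Fresh.exists_name x ({a, c} : Finset 𝔸)
  simp only [Finset.mem_insert, Finset.mem_singleton, not_or] at hd
  refine ⟨d, hd.1, hdx, hd.2, ?_, (swap_triple hc hdx hca hd.1).symm⟩
  have := hdx.smul (FinPerm.swap c a)
  rwa [FinPerm.swap_smul, if_neg hd.2, if_neg hd.1] at this

/-- The setoid of `α`-equivalence. -/
def alphaSetoid (𝔸 : Type) [DecidableEq 𝔸] [Infinite 𝔸] (S : Type v) [Nominal 𝔸 S] :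
    Setoid (𝔸 × S) where
  r := AlphaEquiv
  iseqv := by
    refine ⟨fun p => ?_, fun h => ?_, fun {p q r} h k => ?_⟩
    · obtain ⟨c, hc, hcx⟩ := Fresh.exists_name p.2 ({p.1} : Finset 𝔸)
      simp only [Finset.mem_singleton] at hc
      exact ⟨c, hc, hcx, hc, hcx, rfl⟩
    · obtain ⟨c, h1, h2, h3, h4, h⟩ := h
      exact ⟨c, h3, h4, h1, h2, h.symm⟩
    · obtain ⟨c, hc, hcp⟩ := Fresh.exists_name (p.2) ({p.1, q.1, r.1} ∪
        (Nominal.exists_support (𝔸 := 𝔸) q.2).choose ∪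
        (Nominal.exists_support (𝔸 := 𝔸) r.2).choose)
      simp only [Finset.mem_union, Finset.mem_insert, Finset.mem_singleton, not_or] at hc
      have hcq : Fresh c q.2 := ⟨_, (Nominal.exists_support (𝔸 := 𝔸) q.2).choose_spec, hc.1.2⟩
      have hcr : Fresh c r.2 := ⟨_, (Nominal.exists_support (𝔸 := 𝔸) r.2).choose_spec, hc.2⟩
      exact ⟨c, hc.1.1.1, hcp, hc.1.1.2.2, hcr,
        (h.forall_fresh hc.1.1.1 hcp hc.1.1.2.1 hcq).trans
          (k.forall_fresh hc.1.1.2.1 hcq hc.1.1.2.2 hcr)⟩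

end Alpha

/-! ### The category of 01-substitution sets -/

/-- A 01-substitution set with names in `𝔸`; `sub x a i` is `x(a := i)`, with `2 = Bool`
(`false` is `0`, `true` is `1`). -/
structure ZOSub (𝔸 : Type) where
  carrier : Type v
  [nominal : Nominal 𝔸 carrier]
  sub : carrier → 𝔸 → Bool → carrier
  smul_sub : ∀ (π : FinPerm 𝔸) (x : carrier) (a : 𝔸) (i : Bool),
    π • sub x a i = sub (π • x) (π • a) i
  fresh_sub : ∀ (x : carrier) (a : 𝔸) (i : Bool), Fresh a (sub x a i)
  sub_of_fresh : ∀ (x : carrier) (a : 𝔸) (i : Bool), Fresh a x → sub x a i = x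
  sub_comm : ∀ (x : carrier) (a a' : 𝔸) (i i' : Bool), a ≠ a' →
    sub (sub x a i) a' i' = sub (sub x a' i') a i

attribute [instance] ZOSub.nominal

instance ZOSub.instCoeSort (𝔸 : Type) : CoeSort (ZOSub.{v} 𝔸) (Type v) := ⟨ZOSub.carrier⟩

/-- Morphisms of 01-substitution sets. -/
@[ext]
structure ZOSub.Hom {𝔸 : Type} (X Y : ZOSub.{v} 𝔸) where
  toFun : X → Y
  map_smul : ∀ (π : FinPerm 𝔸) (x : X), toFun (π • x) = π • toFun x
  map_sub : ∀ (x : X) (a : 𝔸) (i : Bool), toFun (X.sub x a i) = Y.sub (toFun x) a i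

instance ZOSub.instCategory (𝔸 : Type) : Category (ZOSub.{v} 𝔸) where
  Hom := ZOSub.Hom
  id X := ⟨id, fun _ _ => rfl, fun _ _ _ => rfl⟩
  comp f g := ⟨g.toFun ∘ f.toFun, fun π x => by simp [f.map_smul, g.map_smul],
    fun x a i => by simp [f.map_sub, g.map_sub]⟩

instance ZOSub.instFunLike {𝔸 : Type} (X Y : ZOSub.{v} 𝔸) : FunLike (X ⟶ Y) X Y where
  coe f := ZOSub.Hom.toFun f
  coe_injective _ _ h := ZOSub.Hom.ext h

section HomLemmas

variable {𝔸 : Type} {X Y Z : ZOSub.{v} 𝔸}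

@[simp] theorem ZOSub.id_apply (x : X) : (𝟙 X : X ⟶ X) x = x := rfl

@[simp] theorem ZOSub.comp_apply (f : X ⟶ Y) (g : Y ⟶ Z) (x : X) : (f ≫ g) x = g (f x) := rfl

theorem ZOSub.hom_ext {f g : X ⟶ Y} (h : ∀ x, f x = g x) : f = g := DFunLike.ext f g h

theorem ZOSub.hom_smul (f : X ⟶ Y) (π : FinPerm 𝔸) (x : X) : f (π • x) = π • f x :=
  ZOSub.Hom.map_smul f π x

theorem ZOSub.hom_sub (f : X ⟶ Y) (x : X) (a : 𝔸) (i : Bool) :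
    f (X.sub x a i) = Y.sub (f x) a i :=
  ZOSub.Hom.map_sub f x a i

theorem ZOSub.hom_fresh (f : X ⟶ Y) {a : 𝔸} {x : X} (h : Fresh a x) :
    Fresh a (f x) :=
  Fresh.map (F := f) (ZOSub.hom_smul f) h

/-- A name that is fresh for `x` and different from `b` is fresh for `x(b := i)`. -/
theorem ZOSub.fresh_sub_of_fresh [DecidableEq 𝔸] [Infinite 𝔸] {a b : 𝔸} {x : X} (i : Bool)
    (h : Fresh a x) (hab : a ≠ b) : Fresh a (X.sub x b i) := by
  obtain ⟨B, hB⟩ := Nominal.exists_support (𝔸 := 𝔸) x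
  obtain ⟨c, hc, hcx⟩ := Fresh.exists_name (X.sub x b i) ({b} ∪ B)
  simp only [Finset.mem_union, Finset.mem_singleton, not_or] at hc
  refine Fresh.of_swap hcx ?_
  rw [X.smul_sub, h.swap_smul_eq ⟨B, hB, hc.2⟩, FinPerm.swap_smul, if_neg hab.symm,
    if_neg (Ne.symm hc.1)]

end HomLemmas

/-! ### Open boxes, fillers, Kan fibrations -/

/-- An `e`-open `(A, a)`-box `(u, y)` over `p : Z ⟶ Y`, where `e` is `0` or `1`. The function
`u : (A × 2) \ {(a, e)} → Z` is given as a partial function on `𝔸 × 2` with that domain. -/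
@[ext]
structure OpenBox {𝔸 : Type} {Z Y : ZOSub.{v} 𝔸} (e : Bool) (p : Z ⟶ Y) where
  A : Finset 𝔸
  a : 𝔸
  u : 𝔸 → Bool → Option Z
  y : Y
  mem : a ∈ A
  dom : ∀ (b : 𝔸) (i : Bool), (u b i).isSome ↔ b ∈ A ∧ (b, i) ≠ (a, e)
  fresh : ∀ (b : 𝔸) (i : Bool) (z : Z), u b i = some z → Fresh b z
  adj : ∀ (b b' : 𝔸) (i i' : Bool) (z z' : Z), b ≠ b' → u b i = some z → u b' i' = some z' →
    Z.sub z b' i' = Z.sub z' b i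
  lies_over : ∀ (b : 𝔸) (i : Bool) (z : Z), u b i = some z → p z = Y.sub y b i

namespace OpenBox

variable {𝔸 : Type} [DecidableEq 𝔸] [Infinite 𝔸] {Z Y : ZOSub.{v} 𝔸} {e : Bool} {p : Z ⟶ Y}

instance : SMul (FinPerm 𝔸) (OpenBox e p) where
  smul π b :=
    { A := π • b.A
      a := π • b.a
      u := fun c i => (b.u (π⁻¹ • c) i).map (π • ·)
      y := π • b.y
      mem := by simpa using b.mem
      dom := fun c i => by
        rw [Option.isSome_map, b.dom, Finset.inv_smul_mem_iff, Ne, Ne, Prod.mk.injEq,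
          Prod.mk.injEq, inv_smul_eq_iff]
      fresh := fun c i z hz => by
        obtain ⟨w, hw, rfl⟩ := Option.map_eq_some_iff.1 hz
        simpa using (b.fresh _ _ _ hw).smul π
      adj := fun c c' i i' z z' hcc hz hz' => by
        obtain ⟨w, hw, rfl⟩ := Option.map_eq_some_iff.1 hz
        obtain ⟨w', hw', rfl⟩ := Option.map_eq_some_iff.1 hz'
        have := congrArg (π • ·) (b.adj _ _ _ _ _ _
          (fun h => hcc (smul_left_cancel _ h)) hw hw')
        simpa [Z.smul_sub] using this
      lies_over := fun c i z hz => by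
        obtain ⟨w, hw, rfl⟩ := Option.map_eq_some_iff.1 hz
        rw [ZOSub.hom_smul, b.lies_over _ _ _ hw, Y.smul_sub, smul_inv_smul] }

theorem smul_A (π : FinPerm 𝔸) (b : OpenBox e p) : (π • b).A = π • b.A := rfl
theorem smul_a (π : FinPerm 𝔸) (b : OpenBox e p) : (π • b).a = π • b.a := rfl
theorem smul_y (π : FinPerm 𝔸) (b : OpenBox e p) : (π • b).y = π • b.y := rfl
theorem smul_u (π : FinPerm 𝔸) (b : OpenBox e p) (c : 𝔸) (i : Bool) :
    (π • b).u c i = (b.u (π⁻¹ • c) i).map (π • ·) := rfl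

instance : MulAction (FinPerm 𝔸) (OpenBox e p) where
  one_smul b := by
    ext1
    · simp [smul_A]
    · simp [smul_a]
    · funext c i; simp [smul_u]
    · simp [smul_y]
  mul_smul π σ b := by
    ext1
    · simp [smul_A, mul_smul]
    · simp [smul_a, mul_smul]
    · funext c i
      simp only [smul_u, mul_inv_rev, mul_smul, Option.map_map]
      rfl
    · simp [smul_y, mul_smul]

/-- The value of `u` at a point of its domain. -/
def face (b : OpenBox e p) (c : 𝔸) (i : Bool) (h : c ∈ b.A ∧ (c, i) ≠ (b.a, e)) : Z :=
  (b.u c i).get ((b.dom c i).2 h)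

theorem u_eq_face (b : OpenBox e p) {c : 𝔸} {i : Bool} (h : c ∈ b.A ∧ (c, i) ≠ (b.a, e)) :
    b.u c i = some (b.face c i h) := by simp [face]

theorem u_eq_none (b : OpenBox e p) {c : 𝔸} {i : Bool} (h : ¬ (c ∈ b.A ∧ (c, i) ≠ (b.a, e))) :
    b.u c i = none := by
  rw [← b.dom] at h; simpa using h

theorem mem_of_u (b : OpenBox e p) {c : 𝔸} {i : Bool} {z : Z} (h : b.u c i = some z) :
    c ∈ b.A ∧ (c, i) ≠ (b.a, e) := (b.dom c i).1 (by simp [h])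

theorem face_smul (π : FinPerm 𝔸) (b : OpenBox e p) (c : 𝔸) (i : Bool) (h)
    (h' : π • c ∈ (π • b).A ∧ (π • c, i) ≠ ((π • b).a, e)) :
    (π • b).face (π • c) i h' = π • b.face c i h := by
  apply Option.some_injective
  rw [← u_eq_face, smul_u, inv_smul_smul, b.u_eq_face h]; rfl

/-- If a finite set of names supports all the data of a box, it supports the box. -/
theorem smul_eq_self {π : FinPerm 𝔸} {b : OpenBox e p} (hA : ∀ c ∈ b.A, π • c = c)
    (hu : ∀ c i z, b.u c i = some z → π • z = z) (hy : π • b.y = b.y) : π • b = b := by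
  have hA' : π • b.A = b.A := by
    ext c
    rw [← Finset.inv_smul_mem_iff]
    constructor
    · intro h
      have := hA _ h
      rw [smul_inv_smul] at this
      rwa [← this] at h
    · intro h
      have := hA _ h
      rw [← inv_smul_eq_iff.2 this.symm] at h
      exact h
  ext1
  · exact hA'
  · exact hA _ b.mem
  · funext c i
    rw [smul_u]
    by_cases hc : c ∈ b.A
    · rw [inv_smul_eq_iff.2 (hA c hc).symm]
      cases h : b.u c i with
      | none => rfl
      | some z => simp [hu c i z h]
    · rw [u_eq_none b (c := c) (fun h => hc h.1), u_eq_none b]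
      · rfl
      · rintro ⟨h, -⟩
        rw [Finset.inv_smul_mem_iff, hA'] at h
        exact hc h
  · exact hy

instance : Nominal 𝔸 (OpenBox e p) where
  exists_support b := by
    classical
    choose S hS using fun z : Z => Nominal.exists_support (𝔸 := 𝔸) z
    choose T hT using fun y : Y => Nominal.exists_support (𝔸 := 𝔸) y
    refine ⟨b.A ∪ T b.y ∪ (b.A ×ˢ Finset.univ).biUnion
      (fun q => (b.u q.1 q.2).elim ∅ S), fun π hπ => ?_⟩
    refine smul_eq_self (fun c hc => hπ (by simp [hc])) (fun c i z hz => hS z π fun d hd => ?_)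
      (hT _ π fun d hd => hπ (by
        simp only [Finset.coe_union, Set.mem_union]; exact Or.inl (Or.inr hd)))
    refine hπ ?_
    simp only [Finset.coe_union, Set.mem_union]
    refine Or.inr ?_
    rw [Finset.mem_coe, Finset.mem_biUnion]
    exact ⟨(c, i), by simp [(b.mem_of_u hz).1], by simpa [hz] using hd⟩

/-- A name fresh for a box is not in `A`. -/
theorem notMem_of_fresh {b : OpenBox e p} {c : 𝔸} (h : Fresh c b) : c ∉ b.A := by
  intro hc
  obtain ⟨d, hd, hdb⟩ := Fresh.exists_name b b.A
  have h1 := congrArg OpenBox.A (h.swap_smul_eq hdb)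
  rw [smul_A] at h1
  have : FinPerm.swap c d • c ∈ FinPerm.swap c d • b.A := by simpa using hc
  rw [h1, FinPerm.swap_smul, if_pos rfl] at this
  exact hd this

theorem fresh_y {b : OpenBox e p} {c : 𝔸} (h : Fresh c b) : Fresh c b.y :=
  h.map (F := OpenBox.y) fun _ _ => rfl

theorem fresh_u {b : OpenBox e p} {c d : 𝔸} {i : Bool} {z : Z} (h : Fresh c b)
    (hz : b.u d i = some z) : Fresh c z := by
  have hdc : d ≠ c := by rintro rfl; exact notMem_of_fresh h (b.mem_of_u hz).1
  obtain ⟨B, hB⟩ := Nominal.exists_support (𝔸 := 𝔸) b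
  obtain ⟨k, hk, hkz⟩ := Fresh.exists_name z ({d} ∪ B)
  simp only [Finset.mem_union, Finset.mem_singleton, not_or] at hk
  refine Fresh.of_swap hkz ?_
  have h1 := h.swap_smul_eq (c := k) ⟨B, hB, hk.2⟩
  have h2 : (FinPerm.swap c k • b).u (FinPerm.swap c k • d) i =
      some (FinPerm.swap c k • z) := by
    rw [smul_u, inv_smul_smul, hz]; rfl
  rw [h1, FinPerm.swap_smul, if_neg hdc, if_neg (Ne.symm hk.1), hz] at h2
  exact (Option.some_injective _ h2).symm

/-- The substitution `(u, y)(c := i)` for `c ∉ A`, computed componentwise. -/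
def sub (b : OpenBox e p) (c : 𝔸) (i : Bool) (hc : c ∉ b.A) : OpenBox e p where
  A := b.A
  a := b.a
  u := fun d j => (b.u d j).map fun z => Z.sub z c i
  y := Y.sub b.y c i
  mem := b.mem
  dom := fun d j => by rw [Option.isSome_map, b.dom]
  fresh := fun d j z hz => by
    obtain ⟨w, hw, rfl⟩ := Option.map_eq_some_iff.1 hz
    refine ZOSub.fresh_sub_of_fresh i (b.fresh _ _ _ hw) ?_
    rintro rfl
    exact hc (b.mem_of_u hw).1
  adj := fun d d' j j' z z' hdd hz hz' => by
    obtain ⟨w, hw, rfl⟩ := Option.map_eq_some_iff.1 hz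
    obtain ⟨w', hw', rfl⟩ := Option.map_eq_some_iff.1 hz'
    have hd : c ≠ d := by rintro rfl; exact hc (b.mem_of_u hw).1
    have hd' : c ≠ d' := by rintro rfl; exact hc (b.mem_of_u hw').1
    rw [Z.sub_comm _ _ _ _ _ hd', b.adj _ _ _ _ _ _ hdd hw hw', Z.sub_comm _ _ _ _ _ hd.symm]
  lies_over := fun d j z hz => by
    obtain ⟨w, hw, rfl⟩ := Option.map_eq_some_iff.1 hz
    have hd : c ≠ d := by rintro rfl; exact hc (b.mem_of_u hw).1
    rw [ZOSub.hom_sub, b.lies_over _ _ _ hw, Y.sub_comm _ _ _ _ _ hd.symm]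

theorem smul_sub (π : FinPerm 𝔸) (b : OpenBox e p) (c : 𝔸) (i : Bool) (hc : c ∉ b.A)
    (hc' : π • c ∉ (π • b).A) : π • b.sub c i hc = (π • b).sub (π • c) i hc' := by
  ext1
  · rfl
  · rfl
  · funext d j
    simp only [smul_u, sub, Option.map_map]
    congr 1
    funext z
    simp [Z.smul_sub]
  · simp [smul_y, sub, Y.smul_sub]

theorem smul_notMem {π : FinPerm 𝔸} {b : OpenBox e p} {c : 𝔸} (hc : c ∉ b.A) :
    π • c ∉ (π • b).A := by simpa [smul_A] using hc

theorem fresh_sub_of_fresh {b : OpenBox e p} {c d : 𝔸} {i : Bool} (hc : c ∉ b.A)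
    (h : Fresh d b) (hdc : d ≠ c) : Fresh d (b.sub c i hc) := by
  obtain ⟨B, hB⟩ := Nominal.exists_support (𝔸 := 𝔸) b
  obtain ⟨k, hk, hkz⟩ := Fresh.exists_name (b.sub c i hc) ({c} ∪ B)
  simp only [Finset.mem_union, Finset.mem_singleton, not_or] at hk
  refine Fresh.of_swap hkz ?_
  have h1 := h.swap_smul_eq (c := k) ⟨B, hB, hk.2⟩
  have h2 : FinPerm.swap d k • c = c := by
    rw [FinPerm.swap_smul, if_neg hdc.symm, if_neg (Ne.symm hk.1)]
  rw [smul_sub _ _ _ _ _ (smul_notMem hc)]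
  simp only [h1, h2]

theorem fresh_sub_self (b : OpenBox e p) (c : 𝔸) (i : Bool) (hc : c ∉ b.A) :
    Fresh c (b.sub c i hc) := by
  obtain ⟨k, hk, hkb⟩ := Fresh.exists_name (b.sub c i hc) ({c} ∪ b.A)
  simp only [Finset.mem_union, Finset.mem_singleton, not_or] at hk
  refine Fresh.of_swap hkb (smul_eq_self (fun d hd => ?_) (fun d j z hz => ?_) ?_)
  · rw [FinPerm.swap_smul, if_neg, if_neg]
    · rintro rfl; exact hk.2 hd
    · rintro rfl; exact hc hd
  · have hkz := fresh_u hkb hz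
    obtain ⟨w, hw, rfl⟩ := Option.map_eq_some_iff.1 hz
    exact (Z.fresh_sub w c i).swap_smul_eq hkz
  · exact (Y.fresh_sub _ c i).swap_smul_eq (fresh_y hkb)

theorem sub_of_fresh {b : OpenBox e p} {c : 𝔸} (i : Bool) (hc : c ∉ b.A) (h : Fresh c b) :
    b.sub c i hc = b := by
  ext1
  · rfl
  · rfl
  · funext d j
    cases hz : b.u d j with
    | none => simp [sub, hz]
    | some z => simp [sub, hz, Z.sub_of_fresh _ _ _ (fresh_u h hz)]
  · exact Y.sub_of_fresh _ _ _ (fresh_y h)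

theorem sub_comm (b : OpenBox e p) (c c' : 𝔸) (i i' : Bool) (hc : c ∉ b.A) (hc' : c' ∉ b.A)
    (h : c ≠ c') : (b.sub c i hc).sub c' i' hc' = (b.sub c' i' hc').sub c i hc := by
  ext1
  · rfl
  · rfl
  · funext d j
    cases hz : b.u d j with
    | none => simp [sub, hz]
    | some z => simp [sub, hz, Z.sub_comm _ _ _ _ _ h]
  · exact Y.sub_comm _ _ _ _ _ h

/-- The image `(h ∘ u, y)` of a box under a morphism `h` over `Y`. -/
def map {Z' : ZOSub.{v} 𝔸} {p' : Z' ⟶ Y} (h : Z ⟶ Z') (hp : ∀ z, p' (h z) = p z)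
    (b : OpenBox e p) : OpenBox e p' where
  A := b.A
  a := b.a
  u := fun d j => (b.u d j).map h
  y := b.y
  mem := b.mem
  dom := fun d j => by rw [Option.isSome_map, b.dom]
  fresh := fun d j z hz => by
    obtain ⟨w, hw, rfl⟩ := Option.map_eq_some_iff.1 hz
    exact ZOSub.hom_fresh h (b.fresh _ _ _ hw)
  adj := fun d d' j j' z z' hdd hz hz' => by
    obtain ⟨w, hw, rfl⟩ := Option.map_eq_some_iff.1 hz
    obtain ⟨w', hw', rfl⟩ := Option.map_eq_some_iff.1 hz'
    rw [← ZOSub.hom_sub, ← ZOSub.hom_sub, b.adj _ _ _ _ _ _ hdd hw hw']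
  lies_over := fun d j z hz => by
    obtain ⟨w, hw, rfl⟩ := Option.map_eq_some_iff.1 hz
    rw [hp, b.lies_over _ _ _ hw]

theorem map_smul {Z' : ZOSub.{v} 𝔸} {p' : Z' ⟶ Y} (h : Z ⟶ Z') (hp : ∀ z, p' (h z) = p z)
    (π : FinPerm 𝔸) (b : OpenBox e p) : (π • b).map h hp = π • b.map h hp := by
  ext1
  · rfl
  · rfl
  · funext d j
    simp only [smul_u, map, Option.map_map]
    congr 1
    funext z
    simp [ZOSub.hom_smul]
  · rfl

theorem map_sub {Z' : ZOSub.{v} 𝔸} {p' : Z' ⟶ Y} (h : Z ⟶ Z') (hp : ∀ z, p' (h z) = p z)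
    (b : OpenBox e p) (c : 𝔸) (i : Bool) (hc : c ∉ b.A) :
    (b.sub c i hc).map h hp = (b.map h hp).sub c i hc := by
  ext1
  · rfl
  · rfl
  · funext d j
    simp only [sub, map, Option.map_map]
    congr 1
    funext z
    simp [ZOSub.hom_sub]
  · rfl

/-- `x` is a filler of the open box `b = (u, y)`. -/
def IsFiller (b : OpenBox e p) (x : Z) : Prop :=
  (∀ (c : 𝔸) (i : Bool) (z : Z), b.u c i = some z → Z.sub x c i = z) ∧ p x = b.y

end OpenBox

/-- `f` is a Kan fibration: for `e = 1` and for `e = 0` it admits a Kan filling operator for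
`e`-open boxes, uniform with respect to permutations and substitutions. -/
def IsKanFibration {𝔸 : Type} [DecidableEq 𝔸] [Infinite 𝔸] {X Y : ZOSub.{v} 𝔸} (f : X ⟶ Y) :
    Prop :=
  ∀ e : Bool, ∃ fill : OpenBox e f → X,
    (∀ b : OpenBox e f, b.IsFiller (fill b)) ∧
    (∀ (π : FinPerm 𝔸) (b : OpenBox e f), fill (π • b) = π • fill b) ∧
    (∀ (b : OpenBox e f) (c : 𝔸) (i : Bool) (hc : c ∉ b.A),
      fill (b.sub c i hc) = X.sub (fill b) c i)

/-! ### The factorisation `X ⟶ K f ⟶ Y` -/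

/-- The nominal set of classes `⟨a⟩(u, y)`, where `(u, y)` is an `e`-open `(A, a)`-box over `p` for
some `A`: the image in the name abstraction `[𝔸](OpenBox e p)` of the set of pairs `(a, (u, y))`
such that `(u, y)` is an `(A, a)`-box. -/
def Comp {𝔸 : Type} [DecidableEq 𝔸] [Infinite 𝔸] {Z Y : ZOSub.{v} 𝔸} (e : Bool) (p : Z ⟶ Y) :
    Type v :=
  Quotient ((alphaSetoid 𝔸 (OpenBox e p)).comap fun b => (b.a, b))

theorem FinPerm.smul_swap {𝔸 : Type} [DecidableEq 𝔸] {S : Type v} [MulAction (FinPerm 𝔸) S]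
    (π : FinPerm 𝔸) (a b : 𝔸) (x : S) :
    π • FinPerm.swap a b • x = FinPerm.swap (π • a) (π • b) • π • x := by
  have : π * FinPerm.swap a b = FinPerm.swap (π • a) (π • b) * π := by
    apply FinPerm.ext_smul
    intro c
    simp only [mul_smul, FinPerm.swap_smul]
    by_cases h1 : c = a
    · simp [h1]
    · by_cases h2 : c = b
      · subst h2; simp [h1]
      · simp [h1, h2]
  rw [← mul_smul, this, mul_smul]

namespace Comp

variable {𝔸 : Type} [DecidableEq 𝔸] [Infinite 𝔸] {Z Y : ZOSub.{v} 𝔸} {e : Bool} {p : Z ⟶ Y}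

/-- The class `⟨a⟩(u, y)` of an `(A, a)`-box `(u, y)`. -/
def mk (b : OpenBox e p) : Comp e p := Quotient.mk _ b

theorem ind {P : Comp e p → Prop} (h : ∀ b, P (mk b)) (q : Comp e p) : P q := Quotient.ind h q

theorem mk_eq_iff {b b' : OpenBox e p} :
    mk b = mk b' ↔ AlphaEquiv (b.a, b) (b'.a, b') := Quotient.eq

theorem mk_swap {b : OpenBox e p} {c : 𝔸} (hc : c ≠ b.a) (h : Fresh c b) :
    mk (FinPerm.swap c b.a • b) = mk b := by
  refine Eq.symm (mk_eq_iff.2 ?_)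
  have := alphaEquiv_swap hc h
  rwa [OpenBox.smul_a, FinPerm.swap_smul, if_neg (Ne.symm hc), if_pos rfl]

/-- Functions on classes `⟨a⟩(u, y)` from functions on boxes that are invariant under renaming of
`a` to a fresh name. -/
def lift {β : Type v} (F : OpenBox e p → β)
    (hF : ∀ (b : OpenBox e p) (c : 𝔸), c ≠ b.a → Fresh c b → F (FinPerm.swap c b.a • b) = F b)
    (q : Comp e p) : β :=
  Quotient.lift F (fun b b' h => by
    obtain ⟨c, h1, h2, h3, h4, h⟩ := h
    exact (hF b c h1 h2).symm.trans ((congrArg F h).trans (hF b' c h3 h4))) q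

instance : SMul (FinPerm 𝔸) (Comp e p) where
  smul π := lift (fun b => mk (π • b)) fun b c hc h => by
    rw [FinPerm.smul_swap, ← OpenBox.smul_a]
    refine mk_swap ?_ (h.smul π)
    simpa [OpenBox.smul_a] using hc

theorem smul_mk (π : FinPerm 𝔸) (b : OpenBox e p) : π • mk b = mk (π • b) := rfl

instance : MulAction (FinPerm 𝔸) (Comp e p) where
  one_smul := ind fun b => by rw [smul_mk, one_smul]
  mul_smul π σ := ind fun b => by rw [smul_mk, smul_mk, smul_mk, mul_smul]

instance : Nominal 𝔸 (Comp e p) where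
  exists_support := ind fun b => by
    obtain ⟨B, hB⟩ := Nominal.exists_support (𝔸 := 𝔸) b
    exact ⟨B, fun π hπ => by rw [smul_mk, hB π hπ]⟩

theorem fresh_mk {b : OpenBox e p} {c : 𝔸} (h : Fresh c b) : Fresh c (mk b) :=
  h.map (F := mk) fun π b => (smul_mk π b).symm

theorem fresh_self (b : OpenBox e p) : Fresh b.a (mk b) := by
  obtain ⟨k, hk, hkb⟩ := Fresh.exists_name b ({b.a} : Finset 𝔸)
  simp only [Finset.mem_singleton] at hk
  refine Fresh.of_swap (fresh_mk hkb) ?_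
  have hsw : FinPerm.swap b.a k = FinPerm.swap k b.a := Subtype.ext (Equiv.swap_comm _ _)
  rw [smul_mk, hsw, mk_swap hk hkb]

theorem fresh_of_mk {b : OpenBox e p} {c : 𝔸} (hc : c ≠ b.a) (h : Fresh c (mk b)) :
    Fresh c b := by
  obtain ⟨k, hk, hkb⟩ := Fresh.exists_name b ({b.a} : Finset 𝔸)
  simp only [Finset.mem_singleton] at hk
  refine Fresh.of_swap hkb ?_
  have h1 := h.swap_smul_eq (fresh_mk hkb)
  rw [smul_mk, mk_eq_iff] at h1
  obtain ⟨d, -, -, -, -, hd⟩ := h1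
  simp only [OpenBox.smul_a, FinPerm.swap_smul, if_neg hc.symm, if_neg (Ne.symm hk)] at hd
  exact smul_left_cancel _ hd

theorem exists_rep (q : Comp e p) (C : Finset 𝔸) : ∃ b : OpenBox e p, q = mk b ∧ b.a ∉ C := by
  induction q using ind with
  | h b =>
    obtain ⟨k, hk, hkb⟩ := Fresh.exists_name b ({b.a} ∪ C)
    simp only [Finset.mem_union, Finset.mem_singleton, not_or] at hk
    refine ⟨_, (mk_swap hk.1 hkb).symm, ?_⟩
    rw [OpenBox.smul_a, FinPerm.swap_smul, if_neg (Ne.symm hk.1), if_pos rfl]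
    exact hk.2

end Comp

/-- The disjoint union of `X` with, for `e = 0, 1`, the set of `e`-open boxes over `p` and the set
of classes `⟨a⟩(u, y)` of such boxes. -/
inductive Step {𝔸 : Type} [DecidableEq 𝔸] [Infinite 𝔸] (X : ZOSub.{v} 𝔸) {Z Y : ZOSub.{v} 𝔸}
    (p : Z ⟶ Y) : Type v
  | base (x : X) : Step X p
  | fill (e : Bool) (b : OpenBox e p) : Step X p
  | comp (e : Bool) (q : Comp e p) : Step X p

namespace Step

variable {𝔸 : Type} [DecidableEq 𝔸] [Infinite 𝔸] {X Z Y : ZOSub.{v} 𝔸} {p : Z ⟶ Y}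

instance : SMul (FinPerm 𝔸) (Step X p) where
  smul π s := match s with
    | base x => base (π • x)
    | fill e b => fill e (π • b)
    | comp e q => comp e (π • q)

theorem smul_base (π : FinPerm 𝔸) (x : X) : π • (base x : Step X p) = base (π • x) := rfl
theorem smul_fill (π : FinPerm 𝔸) (e : Bool) (b : OpenBox e p) :
    π • (fill e b : Step X p) = fill e (π • b) := rfl
theorem smul_comp (π : FinPerm 𝔸) (e : Bool) (q : Comp e p) :
    π • (comp e q : Step X p) = comp e (π • q) := rfl

instance : MulAction (FinPerm 𝔸) (Step X p) where
  one_smul s := by cases s <;> simp [smul_base, smul_fill, smul_comp]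
  mul_smul π σ s := by cases s <;> simp [smul_base, smul_fill, smul_comp, mul_smul]

instance : Nominal 𝔸 (Step X p) where
  exists_support s := by
    cases s with
    | base x =>
      obtain ⟨B, hB⟩ := Nominal.exists_support (𝔸 := 𝔸) x
      exact ⟨B, fun π hπ => by rw [smul_base, hB π hπ]⟩
    | fill e b =>
      obtain ⟨B, hB⟩ := Nominal.exists_support (𝔸 := 𝔸) b
      exact ⟨B, fun π hπ => by rw [smul_fill, hB π hπ]⟩
    | comp e q =>
      obtain ⟨B, hB⟩ := Nominal.exists_support (𝔸 := 𝔸) q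
      exact ⟨B, fun π hπ => by rw [smul_comp, hB π hπ]⟩

theorem fresh_base {c : 𝔸} {x : X} : Fresh c (base x : Step X p) ↔ Fresh c x := by
  simp [Fresh, MulAction.Supports, smul_base]
theorem fresh_fill {c : 𝔸} {e : Bool} {b : OpenBox e p} :
    Fresh c (fill e b : Step X p) ↔ Fresh c b := by
  simp [Fresh, MulAction.Supports, smul_fill]
theorem fresh_comp {c : 𝔸} {e : Bool} {q : Comp e p} :
    Fresh c (comp e q : Step X p) ↔ Fresh c q := by
  simp [Fresh, MulAction.Supports, smul_comp]

/-- The substitution `(u, y)(c := i)` of a box `(u, y)`, relative to a map `l` from `Z`. -/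
def fillSub (l : Z → Step X p) {e : Bool} (b : OpenBox e p) (c : 𝔸) (i : Bool) : Step X p :=
  if h : c ∈ b.A ∧ (c, i) ≠ (b.a, e) then l (b.face c i h)
  else if h' : c ∈ b.A then comp e (Comp.mk b)
  else fill e (b.sub c i h')

/-- The substitution `(⟨a⟩(u, y))(c := i)`, relative to a map `l` from `Z`. In the case `c = a`
the name `c` is fresh for `⟨a⟩(u, y)`. -/
def compSub (l : Z → Step X p) {e : Bool} (b : OpenBox e p) (c : 𝔸) (i : Bool) : Step X p :=
  if hc : c = b.a then comp e (Comp.mk b)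
  else if h : c ∈ b.A then
    l (Z.sub (b.face c i ⟨h, fun h' => hc (Prod.mk.inj h').1⟩) b.a e)
  else comp e (Comp.mk (b.sub c i h))

section

variable (l : Z → Step X p) {e : Bool} (b : OpenBox e p)

theorem fillSub_u {c : 𝔸} {i : Bool} {z : Z} (hz : b.u c i = some z) :
    fillSub l b c i = l z := by
  have h := b.mem_of_u hz
  rw [b.u_eq_face h] at hz
  rw [fillSub, dif_pos h, Option.some_injective _ hz]

theorem fillSub_a : fillSub l b b.a e = comp e (Comp.mk b) := by
  rw [fillSub, dif_neg (by simp), dif_pos b.mem]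

theorem fillSub_notMem {c : 𝔸} (i : Bool) (hc : c ∉ b.A) :
    fillSub l b c i = fill e (b.sub c i hc) := by
  rw [fillSub, dif_neg (fun h => hc h.1), dif_neg hc]

theorem compSub_a (i : Bool) : compSub l b b.a i = comp e (Comp.mk b) := by
  rw [compSub, dif_pos rfl]

theorem compSub_u {c : 𝔸} {i : Bool} {z : Z} (hc : c ≠ b.a) (hz : b.u c i = some z) :
    compSub l b c i = l (Z.sub z b.a e) := by
  have h := b.mem_of_u hz
  rw [b.u_eq_face h] at hz
  rw [compSub, dif_neg hc, dif_pos h.1, Option.some_injective _ hz]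

theorem compSub_notMem {c : 𝔸} (i : Bool) (hc : c ∉ b.A) :
    compSub l b c i = comp e (Comp.mk (b.sub c i hc)) := by
  rw [compSub, dif_neg, dif_neg hc]
  rintro rfl
  exact hc b.mem

theorem cases_u (c : 𝔸) (i : Bool) :
    (∃ z, b.u c i = some z) ∨ (c = b.a ∧ i = e) ∨ c ∉ b.A := by
  by_cases h : c ∈ b.A ∧ (c, i) ≠ (b.a, e)
  · exact Or.inl ⟨_, b.u_eq_face h⟩
  · right
    by_cases hc : c ∈ b.A
    · left; simpa [hc] using h
    · exact Or.inr hc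

variable {l}

theorem smul_fillSub (hl : ∀ (π : FinPerm 𝔸) (z : Z), l (π • z) = π • l z) (π : FinPerm 𝔸)
    (c : 𝔸) (i : Bool) : π • fillSub l b c i = fillSub l (π • b) (π • c) i := by
  rcases cases_u b c i with ⟨z, hz⟩ | ⟨rfl, rfl⟩ | hc
  · rw [fillSub_u l b hz, fillSub_u l (π • b) (z := π • z), hl]
    rw [OpenBox.smul_u, inv_smul_smul, hz]; rfl
  · rw [fillSub_a, ← OpenBox.smul_a, fillSub_a]; rfl
  · rw [fillSub_notMem l b i hc, fillSub_notMem l _ i (OpenBox.smul_notMem hc), smul_fill,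
      OpenBox.smul_sub]

theorem smul_compSub (hl : ∀ (π : FinPerm 𝔸) (z : Z), l (π • z) = π • l z) (π : FinPerm 𝔸)
    (c : 𝔸) (i : Bool) : π • compSub l b c i = compSub l (π • b) (π • c) i := by
  by_cases hca : c = b.a
  · subst hca
    rw [compSub_a, ← OpenBox.smul_a, compSub_a]; rfl
  rcases cases_u b c i with ⟨z, hz⟩ | ⟨h, -⟩ | hc
  · rw [compSub_u l b hca hz, compSub_u l (π • b) (z := π • z), ← hl, Z.smul_sub, OpenBox.smul_a]
    · simpa [OpenBox.smul_a] using hca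
    · rw [OpenBox.smul_u, inv_smul_smul, hz]; rfl
  · exact absurd h hca
  · rw [compSub_notMem l b i hc, compSub_notMem l _ i (OpenBox.smul_notMem hc), smul_comp,
      Comp.smul_mk, OpenBox.smul_sub]

theorem compSub_swap (hl : ∀ (π : FinPerm 𝔸) (z : Z), l (π • z) = π • l z) (c : 𝔸) (i : Bool)
    (k : 𝔸) (hk : k ≠ b.a) (hkb : Fresh k b) :
    compSub l (FinPerm.swap k b.a • b) c i = compSub l b c i := by
  have hmk := Comp.mk_swap hk hkb
  have hka : FinPerm.swap k b.a • k = b.a := by rw [FinPerm.swap_smul, if_pos rfl]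
  have hak : FinPerm.swap k b.a • b.a = k := by
    rw [FinPerm.swap_smul, if_neg hk.symm, if_pos rfl]
  have hkA := OpenBox.notMem_of_fresh hkb
  have key : ∀ (hf : Fresh k (compSub l b c i)) (hf' : Fresh b.a (compSub l b c i))
      (_ : FinPerm.swap k b.a • c = c),
      compSub l (FinPerm.swap k b.a • b) c i = compSub l b c i := by
    intro hf hf' hc
    have := smul_compSub b hl (FinPerm.swap k b.a) c i
    rw [hc, hf.swap_smul_eq hf'] at this
    exact this.symm
  by_cases hca : c = b.a
  · subst hca
    have hn : b.a ∉ (FinPerm.swap k b.a • b).A := by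
      have := OpenBox.smul_notMem (π := FinPerm.swap k b.a) hkA
      rwa [hka] at this
    rw [compSub_a, compSub_notMem l _ i hn, OpenBox.sub_of_fresh i hn, hmk]
    have := hkb.smul (FinPerm.swap k b.a)
    rwa [hka] at this
  by_cases hck : c = k
  · subst hck
    have h1 : (FinPerm.swap c b.a • b).a = c := hak
    have h2 := compSub_a l (FinPerm.swap c b.a • b) i
    rw [h1] at h2
    rw [h2, compSub_notMem l b i hkA, OpenBox.sub_of_fresh i hkA hkb, hmk]
  have hcc : FinPerm.swap k b.a • c = c := by
    rw [FinPerm.swap_smul, if_neg hck, if_neg hca]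
  have hfl : ∀ {d : 𝔸} {z : Z}, Fresh d z → Fresh d (l z) := fun h => h.map (F := l) hl
  rcases cases_u b c i with ⟨z, hz⟩ | ⟨h, -⟩ | hc
  · refine key ?_ ?_ hcc
    · rw [compSub_u l b hca hz]
      exact hfl (ZOSub.fresh_sub_of_fresh e (OpenBox.fresh_u hkb hz) hk)
    · rw [compSub_u l b hca hz]
      exact hfl (Z.fresh_sub _ _ _)
  · exact absurd h hca
  · refine key ?_ ?_ hcc
    · rw [compSub_notMem l b i hc, fresh_comp]
      exact Comp.fresh_mk (OpenBox.fresh_sub_of_fresh hc hkb (Ne.symm hck))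
    · rw [compSub_notMem l b i hc, fresh_comp]
      exact Comp.fresh_self (b.sub c i hc)

end

/-- Substitution on `Step X p`, relative to an equivariant map `l` from `Z`. -/
def sub (l : Z → Step X p) (hl : ∀ (π : FinPerm 𝔸) (z : Z), l (π • z) = π • l z)
    (s : Step X p) (c : 𝔸) (i : Bool) : Step X p :=
  match s with
  | base x => base (X.sub x c i)
  | fill _ b => fillSub l b c i
  | comp _ q => q.lift (fun b => compSub l b c i) fun b k hk hkb => compSub_swap b hl c i k hk hkb

/-- The map to `Y`: it sends `x` to `f x`, `(u, y)` to `y` and `⟨a⟩(u, y)` to `y(a := e)`. -/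
def proj (f : X ⟶ Y) (s : Step X p) : Y :=
  match s with
  | base x => f x
  | fill _ b => b.y
  | comp e q => q.lift (fun b => Y.sub b.y b.a e) fun b k hk hkb => by
      have h := Y.smul_sub (FinPerm.swap k b.a) b.y b.a e
      rw [Fresh.swap_smul_eq (ZOSub.fresh_sub_of_fresh e (OpenBox.fresh_y hkb) hk)
        (Y.fresh_sub _ _ _)] at h
      rw [OpenBox.smul_y, OpenBox.smul_a, ← h]

/-- The componentwise map induced by a morphism `h` over `Y`. -/
def map {Z' : ZOSub.{v} 𝔸} {p' : Z' ⟶ Y} (h : Z ⟶ Z') (hp : ∀ z, p' (h z) = p z)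
    (s : Step X p) : Step X p' :=
  match s with
  | base x => base x
  | fill e b => fill e (b.map h hp)
  | comp e q => comp e (q.lift (fun b => Comp.mk (b.map h hp)) fun b k hk hkb => by
      rw [OpenBox.map_smul]
      exact Comp.mk_swap (b := b.map h hp) hk
        (hkb.map (F := fun b => b.map h hp) (OpenBox.map_smul h hp)))

end Step

/-- A stage of the construction for `f : X ⟶ Y`: a map `p : Z ⟶ Y`, and the map `l` over `Y` from
`Z` to the next stage. -/
structure Stage {𝔸 : Type} [DecidableEq 𝔸] [Infinite 𝔸] {X Y : ZOSub.{v} 𝔸} (f : X ⟶ Y) where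
  Z : ZOSub.{v} 𝔸
  p : Z ⟶ Y
  l : Z → Step X p
  l_smul : ∀ (π : FinPerm 𝔸) (z : Z), l (π • z) = π • l z
  l_sub : ∀ (z : Z) (c : 𝔸) (i : Bool), l (Z.sub z c i) = Step.sub l l_smul (l z) c i
  proj_l : ∀ z : Z, Step.proj f (l z) = p z

namespace Stage

variable {𝔸 : Type} [DecidableEq 𝔸] [Infinite 𝔸] {X Y : ZOSub.{v} 𝔸} {f : X ⟶ Y}

theorem sub_sub_fill (S : Stage f) {e : Bool} (b : OpenBox e S.p) (c c' : 𝔸) (i i' : Bool)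
    (hcc : c ≠ c') : Step.sub S.l S.l_smul (Step.fillSub S.l b c i) c' i' =
      Step.sub S.l S.l_smul (Step.fillSub S.l b c' i') c i := by
  have hu : ∀ (c c' : 𝔸) (i i' : Bool) (z : S.Z), c ≠ c' → b.u c i = some z → c' ∉ b.A →
      Step.sub S.l S.l_smul (Step.fillSub S.l b c i) c' i' =
        Step.sub S.l S.l_smul (Step.fillSub S.l b c' i') c i := by
    intro c c' i i' z hcc hz hc'
    rw [Step.fillSub_u _ _ hz, Step.fillSub_notMem _ _ _ hc', ← S.l_sub]
    exact (Step.fillSub_u S.l (b.sub c' i' hc') (by simp [OpenBox.sub, hz])).symm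
  have hua : ∀ (c : 𝔸) (i : Bool) (z : S.Z), c ≠ b.a → b.u c i = some z →
      Step.sub S.l S.l_smul (Step.fillSub S.l b c i) b.a e =
        Step.sub S.l S.l_smul (Step.fillSub S.l b b.a e) c i := by
    intro c i z hc hz
    rw [Step.fillSub_u _ _ hz, Step.fillSub_a, ← S.l_sub]
    exact (Step.compSub_u S.l b hc hz).symm
  have han : ∀ (c : 𝔸) (i : Bool), c ∉ b.A →
      Step.sub S.l S.l_smul (Step.fillSub S.l b b.a e) c i =
        Step.sub S.l S.l_smul (Step.fillSub S.l b c i) b.a e := by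
    intro c i hc
    rw [Step.fillSub_notMem _ _ _ hc, Step.fillSub_a]
    exact (Step.compSub_notMem S.l b i hc).trans (Step.fillSub_a S.l (b.sub c i hc)).symm
  rcases Step.cases_u b c i with ⟨z, hz⟩ | ⟨rfl, rfl⟩ | hc <;>
  rcases Step.cases_u b c' i' with ⟨z', hz'⟩ | ⟨rfl, rfl⟩ | hc'
  · rw [Step.fillSub_u _ _ hz, Step.fillSub_u _ _ hz', ← S.l_sub, ← S.l_sub,
      b.adj _ _ _ _ _ _ hcc hz hz']
  · exact hua _ _ _ hcc hz
  · exact hu _ _ _ _ _ hcc hz hc'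
  · exact (hua _ _ _ hcc.symm hz').symm
  · exact absurd rfl hcc
  · exact han _ _ hc'
  · exact (hu _ _ _ _ _ hcc.symm hz' hc).symm
  · exact (han _ _ hc).symm
  · rw [Step.fillSub_notMem _ _ _ hc, Step.fillSub_notMem _ _ _ hc']
    refine (Step.fillSub_notMem S.l (b.sub c i hc) i' hc').trans ?_
    rw [OpenBox.sub_comm _ _ _ _ _ _ _ hcc]
    exact (Step.fillSub_notMem S.l (b.sub c' i' hc') i hc).symm

theorem sub_sub_comp (S : Stage f) {e : Bool} (b : OpenBox e S.p) (c c' : 𝔸) (i i' : Bool)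
    (hcc : c ≠ c') (hca : c ≠ b.a) (hca' : c' ≠ b.a) :
    Step.sub S.l S.l_smul (Step.compSub S.l b c i) c' i' =
      Step.sub S.l S.l_smul (Step.compSub S.l b c' i') c i := by
  have hu : ∀ (c c' : 𝔸) (i i' : Bool) (z : S.Z), c ≠ c' → c ≠ b.a → c' ≠ b.a →
      b.u c i = some z → c' ∉ b.A →
      Step.sub S.l S.l_smul (Step.compSub S.l b c i) c' i' =
        Step.sub S.l S.l_smul (Step.compSub S.l b c' i') c i := by
    intro c c' i i' z hcc hca hca' hz hc'
    rw [Step.compSub_u _ _ hca hz, Step.compSub_notMem _ _ _ hc', ← S.l_sub,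
      S.Z.sub_comm _ _ _ _ _ hca'.symm]
    exact (Step.compSub_u S.l (b.sub c' i' hc') (z := S.Z.sub z c' i') hca
      (by simp [OpenBox.sub, hz])).symm
  rcases Step.cases_u b c i with ⟨z, hz⟩ | ⟨h, -⟩ | hc
  · rcases Step.cases_u b c' i' with ⟨z', hz'⟩ | ⟨h, -⟩ | hc'
    · rw [Step.compSub_u _ _ hca hz, Step.compSub_u _ _ hca' hz', ← S.l_sub, ← S.l_sub,
        S.Z.sub_comm _ _ _ _ _ hca'.symm, b.adj _ _ _ _ _ _ hcc hz hz',
        S.Z.sub_comm _ _ _ _ _ hca]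
    · exact absurd h hca'
    · exact hu _ _ _ _ _ hcc hca hca' hz hc'
  · exact absurd h hca
  · rcases Step.cases_u b c' i' with ⟨z', hz'⟩ | ⟨h, -⟩ | hc'
    · exact (hu _ _ _ _ _ hcc.symm hca' hca hz' hc).symm
    · exact absurd h hca'
    · rw [Step.compSub_notMem _ _ _ hc, Step.compSub_notMem _ _ _ hc']
      refine (Step.compSub_notMem S.l (b.sub c i hc) i' hc').trans ?_
      rw [OpenBox.sub_comm _ _ _ _ _ _ _ hcc]
      exact (Step.compSub_notMem S.l (b.sub c' i' hc') i hc).symm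

/-- The 01-substitution set underlying the next stage. -/
def next (S : Stage f) : ZOSub.{v} 𝔸 where
  carrier := Step X S.p
  sub := Step.sub S.l S.l_smul
  smul_sub π s c i := by
    cases s with
    | base x => exact congrArg Step.base (X.smul_sub π x c i)
    | fill e b => exact Step.smul_fillSub b S.l_smul π c i
    | comp e q =>
      induction q using Comp.ind with
      | h b => exact Step.smul_compSub b S.l_smul π c i
  fresh_sub s c i := by
    have hfl : ∀ {d : 𝔸} {z : S.Z}, Fresh d z → Fresh d (S.l z) :=
      fun h => h.map (F := S.l) S.l_smul
    cases s with
    | base x => exact Step.fresh_base.2 (X.fresh_sub x c i)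
    | fill e b =>
      change Fresh c (Step.fillSub S.l b c i)
      rcases Step.cases_u b c i with ⟨z, hz⟩ | ⟨rfl, rfl⟩ | hc
      · rw [Step.fillSub_u _ _ hz]
        exact hfl (b.fresh _ _ _ hz)
      · rw [Step.fillSub_a, Step.fresh_comp]
        exact Comp.fresh_self b
      · rw [Step.fillSub_notMem _ _ _ hc, Step.fresh_fill]
        exact OpenBox.fresh_sub_self b c i hc
    | comp e q =>
      obtain ⟨b, rfl, hb⟩ := Comp.exists_rep q {c}
      simp only [Finset.mem_singleton] at hb
      change Fresh c (Step.compSub S.l b c i)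
      rcases Step.cases_u b c i with ⟨z, hz⟩ | ⟨h, -⟩ | hc
      · rw [Step.compSub_u _ _ (Ne.symm hb) hz]
        exact hfl (ZOSub.fresh_sub_of_fresh e (b.fresh _ _ _ hz) (Ne.symm hb))
      · exact absurd h.symm hb
      · rw [Step.compSub_notMem _ _ _ hc, Step.fresh_comp]
        exact Comp.fresh_mk (OpenBox.fresh_sub_self b c i hc)
  sub_of_fresh s c i h := by
    cases s with
    | base x => exact congrArg Step.base (X.sub_of_fresh x c i (Step.fresh_base.1 h))
    | fill e b =>
      have h := Step.fresh_fill.1 h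
      have hc := OpenBox.notMem_of_fresh h
      refine (Step.fillSub_notMem S.l b i hc).trans ?_
      rw [OpenBox.sub_of_fresh i hc h]
    | comp e q =>
      obtain ⟨b, rfl, hb⟩ := Comp.exists_rep q {c}
      simp only [Finset.mem_singleton] at hb
      have h := Comp.fresh_of_mk (Ne.symm hb) (Step.fresh_comp.1 h)
      have hc := OpenBox.notMem_of_fresh h
      refine (Step.compSub_notMem S.l b i hc).trans ?_
      rw [OpenBox.sub_of_fresh i hc h]
  sub_comm s c c' i i' hcc := by
    cases s with
    | base x => exact congrArg Step.base (X.sub_comm x c c' i i' hcc)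
    | fill e b => exact S.sub_sub_fill b c c' i i' hcc
    | comp e q =>
      obtain ⟨b, rfl, hb⟩ := Comp.exists_rep q {c, c'}
      simp only [Finset.mem_insert, Finset.mem_singleton, not_or] at hb
      exact S.sub_sub_comp b c c' i i' hcc (Ne.symm hb.1) (Ne.symm hb.2)

/-- The map from a stage to the next one. -/
def toNext (S : Stage f) : S.Z ⟶ S.next := ⟨S.l, S.l_smul, S.l_sub⟩

/-- The map from the next stage to `Y`. -/
def nextProj (S : Stage f) : S.next ⟶ Y where
  toFun := Step.proj f
  map_smul π s := by
    cases s with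
    | base x => exact ZOSub.hom_smul f π x
    | fill e b => rfl
    | comp e q =>
      induction q using Comp.ind with
      | h b => exact (Y.smul_sub π b.y b.a e).symm
  map_sub s c i := by
    cases s with
    | base x => exact ZOSub.hom_sub f x c i
    | fill e b =>
      change Step.proj f (Step.fillSub S.l b c i) = Y.sub b.y c i
      rcases Step.cases_u b c i with ⟨z, hz⟩ | ⟨rfl, rfl⟩ | hc
      · rw [Step.fillSub_u _ _ hz, S.proj_l, b.lies_over _ _ _ hz]
      · rw [Step.fillSub_a]; rfl
      · rw [Step.fillSub_notMem _ _ _ hc]; rfl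
    | comp e q =>
      obtain ⟨b, rfl, hb⟩ := Comp.exists_rep q {c}
      simp only [Finset.mem_singleton] at hb
      change Step.proj f (Step.compSub S.l b c i) = Y.sub (Y.sub b.y b.a e) c i
      rcases Step.cases_u b c i with ⟨z, hz⟩ | ⟨h, -⟩ | hc
      · rw [Step.compSub_u _ _ (Ne.symm hb) hz, S.proj_l, ZOSub.hom_sub, b.lies_over _ _ _ hz,
          Y.sub_comm _ _ _ _ _ hb]
      · exact absurd h.symm hb
      · rw [Step.compSub_notMem _ _ _ hc]
        exact Y.sub_comm _ _ _ _ _ (Ne.symm hb)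

theorem nextProj_toNext (S : Stage f) (z : S.Z) : S.nextProj (S.toNext z) = S.p z := S.proj_l z

/-- Stage `0` is `X` itself. -/
def zero (f : X ⟶ Y) : Stage f where
  Z := X
  p := f
  l := Step.base
  l_smul _ _ := rfl
  l_sub _ _ _ := rfl
  proj_l _ := rfl

/-- Stage `n + 1` from stage `n`. -/
def succ (S : Stage f) : Stage f where
  Z := S.next
  p := S.nextProj
  l := Step.map S.toNext S.nextProj_toNext
  l_smul π s := by
    cases s with
    | base x => rfl
    | fill e b => exact congrArg (Step.fill e) (OpenBox.map_smul _ _ π b)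
    | comp e q =>
      induction q using Comp.ind with
      | h b => exact congrArg (fun b => Step.comp e (Comp.mk b)) (OpenBox.map_smul _ _ π b)
  l_sub s c i := by
    cases s with
    | base x => rfl
    | fill e b =>
      change Step.map S.toNext S.nextProj_toNext (Step.fillSub S.l b c i) = _
      rcases Step.cases_u b c i with ⟨z, hz⟩ | ⟨rfl, rfl⟩ | hc
      · rw [Step.fillSub_u _ _ hz]
        exact (Step.fillSub_u _ (b.map S.toNext S.nextProj_toNext) (z := S.toNext z)
          (by simp [OpenBox.map, hz])).symm
      · rw [Step.fillSub_a]
        exact (Step.fillSub_a _ (b.map S.toNext S.nextProj_toNext)).symm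
      · rw [Step.fillSub_notMem _ _ _ hc]
        exact (congrArg (Step.fill e) (OpenBox.map_sub _ _ b c i hc)).trans
          (Step.fillSub_notMem _ (b.map S.toNext S.nextProj_toNext) i hc).symm
    | comp e q =>
      obtain ⟨b, rfl, hb⟩ := Comp.exists_rep q {c}
      simp only [Finset.mem_singleton] at hb
      change Step.map S.toNext S.nextProj_toNext (Step.compSub S.l b c i) = _
      rcases Step.cases_u b c i with ⟨z, hz⟩ | ⟨h, -⟩ | hc
      · rw [Step.compSub_u _ _ (Ne.symm hb) hz]
        exact (congrArg _ (ZOSub.hom_sub S.toNext z b.a e)).trans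
          (Step.compSub_u _ (b.map S.toNext S.nextProj_toNext) (z := S.toNext z) (Ne.symm hb)
            (by simp [OpenBox.map, hz])).symm
      · exact absurd h.symm hb
      · rw [Step.compSub_notMem _ _ _ hc]
        exact (congrArg (fun b => Step.comp e (Comp.mk b)) (OpenBox.map_sub _ _ b c i hc)).trans
          (Step.compSub_notMem _ (b.map S.toNext S.nextProj_toNext) i hc).symm
  proj_l s := by
    cases s with
    | base x => rfl
    | fill e b => rfl
    | comp e q =>
      induction q using Comp.ind with
      | h b => rfl

end Stage

/-- The sequence of stages; the 01-substitution set of the `n`-th stage is `K_n f`. -/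
def stage {𝔸 : Type} [DecidableEq 𝔸] [Infinite 𝔸] {X Y : ZOSub.{v} 𝔸} (f : X ⟶ Y) : ℕ → Stage f
  | 0 => Stage.zero f
  | n + 1 => (stage f n).succ

/-- The sequence `K_0 f ⟶ K_1 f ⟶ K_2 f ⟶ ⋯` of 01-substitution sets. -/
def stageFunctor {𝔸 : Type} [DecidableEq 𝔸] [Infinite 𝔸] {X Y : ZOSub.{v} 𝔸} (f : X ⟶ Y) :
    ℕ ⥤ ZOSub.{v} 𝔸 :=
  Functor.ofSequence (X := fun n => (stage f n).Z) fun n => (stage f n).toNext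

section SeqColim

variable {𝔸 : Type} [DecidableEq 𝔸] [Infinite 𝔸] (F : ℕ ⥤ ZOSub.{v} 𝔸)

instance ZOSub.instMulActionHomClass {𝔸 : Type} (X Y : ZOSub.{v} 𝔸) :
    MulActionHomClass (X ⟶ Y) (FinPerm 𝔸) X Y where
  map_smulₛₗ f π x := ZOSub.hom_smul f π x

instance ZOSub.instDirectedSystem : DirectedSystem (fun n => (F.obj n : Type v))
    (fun _ _ h => ⇑(F.map (homOfLE h))) where
  map_self i x := by
    have : homOfLE (le_refl i) = 𝟙 i := rfl
    rw [this, F.map_id, ZOSub.id_apply]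
  map_map _ _ _ hij hjk x := by
    rw [← ZOSub.comp_apply, ← F.map_comp]
    rfl

/-- The colimit of a sequence of 01-substitution sets, on the colimit of the underlying sets. -/
noncomputable def seqColim : ZOSub.{v} 𝔸 where
  carrier := DirectLimit (fun n => (F.obj n : Type v)) (fun _ _ h => F.map (homOfLE h))
  nominal :=
    { exists_support := DirectLimit.induction _ fun n x => by
        obtain ⟨B, hB⟩ := Nominal.exists_support (𝔸 := 𝔸) x
        exact ⟨B, fun π hπ => by rw [DirectLimit.smul_def, hB π hπ]⟩ }
  sub z c i := DirectLimit.map (fun _ _ h => F.map (homOfLE h)) (fun _ _ h => F.map (homOfLE h))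
    (fun n (x : F.obj n) => (F.obj n).sub x c i)
    (fun _ _ h x => ZOSub.hom_sub (F.map (homOfLE h)) x c i) z
  smul_sub π z c i := by
    induction z using DirectLimit.induction with
    | ih n x =>
      simp only [DirectLimit.map_def, DirectLimit.smul_def, (F.obj n).smul_sub]
  fresh_sub z c i := by
    induction z using DirectLimit.induction with
    | ih n x =>
      obtain ⟨B, hB, hc⟩ := (F.obj n).fresh_sub x c i
      refine ⟨B, fun π hπ => ?_, hc⟩
      simp only [DirectLimit.map_def, DirectLimit.smul_def, hB π hπ]
  sub_of_fresh z c i h := by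
    induction z using DirectLimit.induction with
    | ih n x =>
      obtain ⟨k, -, hk⟩ := Fresh.exists_name x (∅ : Finset 𝔸)
      have hk' : Fresh k (Quotient.mk (DirectLimit.setoid fun _ _ h => F.map (homOfLE h))
          ⟨n, x⟩) := by
        obtain ⟨B, hB, hc⟩ := hk
        exact ⟨B, fun π hπ => by rw [DirectLimit.smul_def, hB π hπ], hc⟩
      have h1 := h.swap_smul_eq hk'
      rw [DirectLimit.smul_def] at h1
      obtain ⟨m, hm, hm', h1⟩ := Quotient.exact h1
      have h2 : Fresh c (F.map (homOfLE hm) x) := by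
        refine Fresh.of_swap (ZOSub.hom_fresh _ hk) ?_
        rw [← ZOSub.hom_smul]
        exact h1
      have h3 := (F.obj m).sub_of_fresh _ _ i h2
      rw [← ZOSub.hom_sub] at h3
      exact Quotient.sound ⟨m, hm, hm, h3⟩
  sub_comm z c c' i i' hcc := by
    induction z using DirectLimit.induction with
    | ih n x =>
      simp only [DirectLimit.map_def, (F.obj n).sub_comm x c c' i i' hcc]

/-- The maps of the colimit cocone. -/
noncomputable def seqColim.incl (n : ℕ) : F.obj n ⟶ seqColim F where
  toFun x := Quotient.mk _ ⟨n, x⟩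
  map_smul _ _ := rfl
  map_sub _ _ _ := rfl

theorem seqColim.incl_map {m n : ℕ} (h : m ≤ n) (x : F.obj m) :
    seqColim.incl F n (F.map (homOfLE h) x) = seqColim.incl F m x :=
  Quotient.sound ⟨n, le_rfl, h, DirectedSystem.map_self (f := fun _ _ h => ⇑(F.map (homOfLE h))) _⟩

/-- The map out of the colimit given by a compatible family of maps. -/
noncomputable def seqColim.desc {Y : ZOSub.{v} 𝔸} (α : F ⟶ (Functor.const ℕ).obj Y) :
    seqColim F ⟶ Y where
  toFun z := DirectLimit.lift (fun _ _ h => F.map (homOfLE h))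
    (fun n (x : F.obj n) => (α.app n : F.obj n ⟶ Y) x)
    (fun m n h x => by
      have := congrArg (fun k : F.obj m ⟶ Y => k x) (α.naturality (homOfLE h))
      exact this.symm) z
  map_smul π z := by
    induction z using DirectLimit.induction with
    | ih n x => exact ZOSub.hom_smul (α.app n : F.obj n ⟶ Y) π x
  map_sub z c i := by
    induction z using DirectLimit.induction with
    | ih n x => exact ZOSub.hom_sub (α.app n : F.obj n ⟶ Y) x c i

end SeqColim

section Factorisation

variable {𝔸 : Type} [DecidableEq 𝔸] [Infinite 𝔸] {X Y : ZOSub.{v} 𝔸} (f : X ⟶ Y)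

/-- `K f`, the colimit of the stages. -/
noncomputable def KObj : ZOSub.{v} 𝔸 := seqColim (stageFunctor f)

/-- `λ_f : X ⟶ K f`, the inclusion of stage `0`. -/
noncomputable def lam : X ⟶ KObj f := seqColim.incl (stageFunctor f) 0

/-- `ρ_f : K f ⟶ Y`, induced by the maps from the stages to `Y`. -/
noncomputable def rho : KObj f ⟶ Y :=
  seqColim.desc (stageFunctor f) <|
    NatTrans.ofSequence (G := (Functor.const ℕ).obj Y) (fun n => (stage f n).p) fun n => by
      have h := Functor.ofSequence_map_homOfLE_succ (X := fun n => (stage f n).Z)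
        (fun n => (stage f n).toNext) n
      exact ZOSub.hom_ext fun z => (congrArg (fun m : (stage f n).Z ⟶ (stage f (n + 1)).Z =>
        (stage f (n + 1)).p (m z)) h).trans ((stage f n).nextProj_toNext z)

theorem lam_rho : lam f ≫ rho f = f := ZOSub.hom_ext fun _ => rfl

end Factorisation

/-! ### Fibre products -/

section FibreProduct

variable {𝔸 : Type} {X Y Z : ZOSub.{v} 𝔸}

/-- The fibre product `X ×_Y Z` of `f : X ⟶ Y` and `g : Z ⟶ Y`. -/
def fibreProd (f : X ⟶ Y) (g : Z ⟶ Y) : ZOSub.{v} 𝔸 where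
  carrier := {q : X × Z // f q.1 = g q.2}
  nominal :=
    { smul := fun π q => ⟨(π • q.1.1, π • q.1.2), by
        rw [ZOSub.hom_smul, ZOSub.hom_smul, q.2]⟩
      one_smul := fun q => Subtype.ext (Prod.ext (one_smul _ q.1.1) (one_smul _ q.1.2))
      mul_smul := fun π σ q =>
        Subtype.ext (Prod.ext (mul_smul π σ q.1.1) (mul_smul π σ q.1.2))
      exists_support := fun q => by
        classical
        obtain ⟨B, hB⟩ := Nominal.exists_support (𝔸 := 𝔸) q.1.1
        obtain ⟨C, hC⟩ := Nominal.exists_support (𝔸 := 𝔸) q.1.2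
        refine ⟨B ∪ C, fun π hπ => Subtype.ext (Prod.ext (hB π fun a ha => hπ ?_)
          (hC π fun a ha => hπ ?_))⟩
        · simp only [Finset.coe_union]; exact Or.inl ha
        · simp only [Finset.coe_union]; exact Or.inr ha }
  sub q a i := ⟨(X.sub q.1.1 a i, Z.sub q.1.2 a i), by
    rw [ZOSub.hom_sub, ZOSub.hom_sub, q.2]⟩
  smul_sub π q a i :=
    Subtype.ext (Prod.ext (X.smul_sub π q.1.1 a i) (Z.smul_sub π q.1.2 a i))
  fresh_sub q a i := by
    classical
    obtain ⟨B, hB, ha⟩ := X.fresh_sub q.1.1 a i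
    obtain ⟨C, hC, ha'⟩ := Z.fresh_sub q.1.2 a i
    refine ⟨B ∪ C, fun π hπ => Subtype.ext (Prod.ext (hB π fun a ha => hπ ?_)
      (hC π fun a ha => hπ ?_)), by simp [ha, ha']⟩
    · simp only [Finset.coe_union]; exact Or.inl ha
    · simp only [Finset.coe_union]; exact Or.inr ha
  sub_of_fresh q a i h := by
    obtain ⟨B, hB, ha⟩ := h
    exact Subtype.ext (Prod.ext
      (X.sub_of_fresh _ _ _ ⟨B, fun π hπ => congrArg (fun q => q.1.1) (hB π hπ), ha⟩)
      (Z.sub_of_fresh _ _ _ ⟨B, fun π hπ => congrArg (fun q => q.1.2) (hB π hπ), ha⟩))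
  sub_comm q a a' i i' h :=
    Subtype.ext (Prod.ext (X.sub_comm _ _ _ _ _ h) (Z.sub_comm _ _ _ _ _ h))

variable (f : X ⟶ Y) (g : Z ⟶ Y)

/-- The first projection `X ×_Y Z ⟶ X`. -/
def fibreFst : fibreProd f g ⟶ X := ⟨fun q => q.1.1, fun _ _ => rfl, fun _ _ _ => rfl⟩

/-- The second projection `X ×_Y Z ⟶ Z`. -/
def fibreSnd : fibreProd f g ⟶ Z := ⟨fun q => q.1.2, fun _ _ => rfl, fun _ _ _ => rfl⟩

theorem fibre_condition : fibreFst f g ≫ f = fibreSnd f g ≫ g := ZOSub.hom_ext fun q => q.2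

variable {f g}

/-- The map `W ⟶ X ×_Y Z` with given components. -/
def fibreLift {W : ZOSub.{v} 𝔸} (h : W ⟶ X) (k : W ⟶ Z) (w : h ≫ f = k ≫ g) :
    W ⟶ fibreProd f g where
  toFun x := ⟨(h x, k x), congrArg (fun m : W ⟶ Y => m x) w⟩
  map_smul π x := Subtype.ext (Prod.ext (ZOSub.hom_smul h π x) (ZOSub.hom_smul k π x))
  map_sub x a i := Subtype.ext (Prod.ext (ZOSub.hom_sub h x a i) (ZOSub.hom_sub k x a i))

variable (f g)

theorem fibre_isPullback : IsPullback (fibreFst f g) (fibreSnd f g) f g :=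
  ⟨⟨fibre_condition f g⟩, ⟨Limits.PullbackCone.IsLimit.mk _
    (fun s => fibreLift s.fst s.snd s.condition) (fun _ => rfl) (fun _ => rfl)
    (fun s _ h1 h2 => ZOSub.hom_ext fun x => Subtype.ext (Prod.ext
      (congrArg (fun m : s.pt ⟶ X => m x) h1) (congrArg (fun m : s.pt ⟶ Z => m x) h2)))⟩⟩

/-- The diagonal `Δ_f : X ⟶ X ×_Y X`. -/
def diag : X ⟶ fibreProd f f := fibreLift (𝟙 X) (𝟙 X) rfl

/-- The pullback `g^*(f) : g^*(X) ⟶ Z` of `f : X ⟶ Y` along `g : Z ⟶ Y`, where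
`g^*(X) = X ×_Y Z`. -/
abbrev baseChange : fibreProd f g ⟶ Z := fibreSnd f g

/-- The canonical map `g^*(X) ×_Z g^*(X) ⟶ X ×_Y X`. -/
def baseChangeMap : fibreProd (baseChange f g) (baseChange f g) ⟶ fibreProd f f :=
  fibreLift (fibreFst _ _ ≫ fibreFst f g) (fibreSnd _ _ ≫ fibreFst f g) (by
    simp only [Category.assoc, fibre_condition f g]
    rw [← Category.assoc, fibre_condition (baseChange f g) (baseChange f g), Category.assoc])

end FibreProduct

/-- The terminal 01-substitution set `1`. -/
def point (𝔸 : Type) : ZOSub.{v} 𝔸 where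
  carrier := PUnit
  nominal :=
    { smul := fun _ x => x
      one_smul := fun _ => rfl
      mul_smul := fun _ _ _ => rfl
      exists_support := fun _ => ⟨∅, fun _ _ => rfl⟩ }
  sub x _ _ := x
  smul_sub _ _ _ _ := rfl
  fresh_sub _ _ _ := ⟨∅, fun _ _ => rfl, by simp⟩
  sub_of_fresh _ _ _ _ := rfl
  sub_comm _ _ _ _ _ _ := rfl

/-! ### The nerve of a metric space -/

/-- Uniformly continuous functions `[0,1]^ℕ → M`; the product metric on `[0,1]^ℕ` induces the
product uniformity. -/
@[ext]
structure CubeFun (M : Type v) [MetricSpace M] where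
  toFun : (ℕ → unitInterval) → M
  unif : UniformContinuous toFun

namespace CubeFun

variable {M : Type v} [MetricSpace M]

/-- The action `(π · F)(r) = F(r ∘ π)`. -/
instance : MulAction (FinPerm ℕ) (CubeFun M) where
  smul π F := ⟨fun r => F.toFun fun n => r (π • n), F.unif.comp <|
    uniformContinuous_pi.2 fun n => Pi.uniformContinuous_proj _ (π • n)⟩
  one_smul _ := rfl
  mul_smul _ _ _ := rfl

theorem smul_toFun (π : FinPerm ℕ) (F : CubeFun M) (r : ℕ → unitInterval) :
    (π • F).toFun r = F.toFun fun n => r (π • n) := rfl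

/-- The endpoint `i` of the unit interval. -/
def endpoint (i : Bool) : unitInterval := if i then 1 else 0

/-- `F(a := i)(r) = F(r')`, where `r'(a) = i` and `r'(b) = r(b)` for `b ≠ a`. -/
def sub (F : CubeFun M) (a : ℕ) (i : Bool) : CubeFun M :=
  ⟨fun r => F.toFun (Function.update r a (endpoint i)), F.unif.comp <|
    uniformContinuous_pi.2 fun n => by
      by_cases h : n = a
      · subst h; simpa using uniformContinuous_const
      · simpa [h] using Pi.uniformContinuous_proj _ n⟩

theorem supports_of_agree {F : CubeFun M} {B : Finset ℕ}
    (h : ∀ r r' : ℕ → unitInterval, (∀ n ∈ B, r n = r' n) → F.toFun r = F.toFun r') :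
    MulAction.Supports (FinPerm ℕ) (B : Set ℕ) F := by
  intro π hπ
  ext r
  rw [smul_toFun]
  exact h _ _ fun n hn => by rw [hπ (Finset.mem_coe.2 hn)]

theorem update_eq {F : CubeFun M} {B : Finset ℕ}
    (hB : MulAction.Supports (FinPerm ℕ) (B : Set ℕ) F) (r : ℕ → unitInterval) {b : ℕ}
    (hb : b ∉ B) (v : unitInterval) : F.toFun (Function.update r b v) = F.toFun r := by
  have hlarge : ∀ m : ℕ, ∀ᶠ n : ℕ in Filter.atTop, n ≠ m := fun m =>
    (Filter.eventually_gt_atTop m).mono fun n hn => (ne_of_gt hn)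
  have hF := F.unif.continuous
  have h1 : Filter.Tendsto (fun n => F.toFun (Function.update r n v)) Filter.atTop
      (nhds (F.toFun r)) := by
    refine (hF.tendsto r).comp (tendsto_pi_nhds.2 fun m => ?_)
    refine tendsto_const_nhds.congr' ((hlarge m).mono fun n hn => ?_)
    simp [hn.symm]
  have h2 : Filter.Tendsto
      (fun n => F.toFun fun m => Function.update r n v (FinPerm.swap b n • m)) Filter.atTop
      (nhds (F.toFun (Function.update r b v))) := by
    refine (hF.tendsto _).comp (tendsto_pi_nhds.2 fun m => ?_)
    refine tendsto_const_nhds.congr'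
      (((hlarge m).and (hlarge b)).mono fun n hn => ?_)
    obtain ⟨hn, hnb⟩ := hn
    by_cases hmb : m = b
    · subst hmb; simp [FinPerm.swap_smul]
    · simp [FinPerm.swap_smul, hmb, hn.symm]
  have h3 : ∀ᶠ n : ℕ in Filter.atTop, n ∉ B := by
    refine (Filter.eventually_gt_atTop (B.sup id)).mono fun n hn hnB => ?_
    exact absurd (Finset.le_sup (f := id) hnB) (not_le.2 hn)
  refine tendsto_nhds_unique (h2.congr' (h3.mono fun n hn => ?_)) h1
  rw [← smul_toFun, hB]
  intro m hm
  rw [FinPerm.swap_smul, if_neg, if_neg]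
  · rintro rfl; exact hn hm
  · rintro rfl; exact hb hm

/-- If `B` supports `F`, then `F(r)` depends only on the restriction of `r` to `B`. -/
theorem agree_of_supports {F : CubeFun M} {B : Finset ℕ}
    (hB : MulAction.Supports (FinPerm ℕ) (B : Set ℕ) F) (r r' : ℕ → unitInterval)
    (h : ∀ n ∈ B, r n = r' n) : F.toFun r = F.toFun r' := by
  have h1 : ∀ k : ℕ, F.toFun (fun n => if n < k then r' n else r n) = F.toFun r := by
    intro k
    induction k with
    | zero => simp
    | succ k ih =>
      rw [← ih]
      by_cases hk : k ∈ B
      · congr 1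
        funext n
        by_cases hn : n = k
        · subst hn; simp [h n hk]
        · have : n < k + 1 ↔ n < k := by omega
          simp [this]
      · refine Eq.trans ?_ (update_eq hB _ hk (r' k))
        congr 1
        funext n
        by_cases hn : n = k
        · subst hn; simp
        · have : n < k + 1 ↔ n < k := by omega
          simp [this, hn]
  have h2 : Filter.Tendsto (fun k => F.toFun (fun n => if n < k then r' n else r n)) Filter.atTop
      (nhds (F.toFun r')) := by
    refine (F.unif.continuous.tendsto _).comp (tendsto_pi_nhds.2 fun m => ?_)
    refine tendsto_const_nhds.congr' ((Filter.eventually_gt_atTop m).mono fun n hn => ?_)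
    simp [hn]
  simp only [h1] at h2
  exact tendsto_nhds_unique tendsto_const_nhds h2

theorem smul_sub (π : FinPerm ℕ) (F : CubeFun M) (a : ℕ) (i : Bool) :
    π • F.sub a i = (π • F).sub (π • a) i := by
  ext r
  simp only [smul_toFun, sub]
  congr 1
  funext n
  by_cases h : n = a
  · subst h; simp
  · simp [h]

theorem exists_support_smul {F : CubeFun M} (π : FinPerm ℕ)
    (h : ∃ B : Finset ℕ, MulAction.Supports (FinPerm ℕ) (B : Set ℕ) F) :
    ∃ B : Finset ℕ, MulAction.Supports (FinPerm ℕ) (B : Set ℕ) (π • F) := by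
  obtain ⟨B, hB⟩ := h
  obtain ⟨c, hc⟩ := Infinite.exists_notMem_finset B
  obtain ⟨C, hC, -⟩ := Fresh.smul (a := c) (x := F) ⟨B, hB, hc⟩ π
  exact ⟨C, hC⟩

theorem supports_sub {F : CubeFun M} {B : Finset ℕ}
    (hB : MulAction.Supports (FinPerm ℕ) (B : Set ℕ) F) (a : ℕ) (i : Bool) :
    MulAction.Supports (FinPerm ℕ) ((B.erase a : Finset ℕ) : Set ℕ) (F.sub a i) := by
  refine supports_of_agree fun r r' h => agree_of_supports hB _ _ fun n hn => ?_
  by_cases hna : n = a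
  · subst hna; simp
  · simpa [hna] using h n (Finset.mem_erase.2 ⟨hna, hn⟩)

end CubeFun

/-- The nerve `N(M)` of a metric space `M`, a 01-substitution set with names in `ℕ`: the uniformly
continuous functions `[0,1]^ℕ → M` that have a finite support. -/
def metricNerve (M : Type v) [MetricSpace M] : ZOSub.{v} ℕ where
  carrier := {F : CubeFun M // ∃ B : Finset ℕ, MulAction.Supports (FinPerm ℕ) (B : Set ℕ) F}
  nominal :=
    { smul := fun π F => ⟨π • F.1, CubeFun.exists_support_smul π F.2⟩
      one_smul := fun F => Subtype.ext (one_smul _ F.1)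
      mul_smul := fun π σ F => Subtype.ext (mul_smul π σ F.1)
      exists_support := fun F => by
        obtain ⟨B, hB⟩ := F.2
        exact ⟨B, fun π hπ => Subtype.ext (hB π hπ)⟩ }
  sub F a i := ⟨F.1.sub a i, by
    obtain ⟨B, hB⟩ := F.2
    exact ⟨_, CubeFun.supports_sub hB a i⟩⟩
  smul_sub π F a i := Subtype.ext (CubeFun.smul_sub π F.1 a i)
  fresh_sub F a i := by
    obtain ⟨B, hB⟩ := F.2
    exact ⟨B.erase a, fun π hπ => Subtype.ext (CubeFun.supports_sub hB a i π hπ), by simp⟩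
  sub_of_fresh F a i h := by
    obtain ⟨B, hB, ha⟩ := h
    have hB' : MulAction.Supports (FinPerm ℕ) (B : Set ℕ) F.1 := fun π hπ =>
      congrArg Subtype.val (hB π hπ)
    exact Subtype.ext (CubeFun.ext (funext fun r => CubeFun.update_eq hB' r ha _))
  sub_comm F a a' i i' h := by
    refine Subtype.ext (CubeFun.ext (funext fun r => ?_))
    change F.1.toFun _ = F.1.toFun _
    rw [Function.update_comm h.symm]

/-- The map `1 ⟶ N(M)` that picks the constant function with value `x`. -/
def nervePoint {M : Type v} [MetricSpace M] (x : M) : point.{v} ℕ ⟶ metricNerve M where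
  toFun _ := ⟨⟨fun _ => x, uniformContinuous_const⟩, ∅, fun _ _ => rfl⟩
  map_smul _ _ := rfl
  map_sub _ _ _ := rfl

/-! ### Countability of `K f` -/

/-! The obstruction is that a composite `⟨a⟩(u, y)` lies over the single end `y(a := e)` of `y`, yet
remembers all of `y`. The fibre of `ρ` over a point therefore contains data about paths in the base
that leave this point, and a pullback that keeps only the point loses these paths. A comparison of
cardinalities turns this into a proof.

On the pulled-back side, `g^*(X)` consists of the constant function `0` alone, so `g^*(X) ×_1
g^*(X)` is a point as well. Open boxes are finite data over a countable set of names, so each stage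
of the construction, and with it the colimit, is countable (`KObj_countable`).

In `K Δ_f` the fibre over the pair of constant functions `0` is uncountable. For each `t` in `[0,1]`
the path `r ↦ t · r(0)`, put on the diagonal, is the base of a `0`-open box with one face, the
constant `t`. Its composite `scaledComp t` lies over the end at `0`, which is the same for all `t`
(`rho_scaledComp`). Different `t` give different composites (`scaledComp_injective`): the end `y(a
:= 1 - e)` opposite to the projection does not depend on the representative of `⟨a⟩(u, y)` and
survives the passage to later stages, hence is an invariant of elements of the colimit, and here it
recovers `t`.

If the square were a pullback, each element of this fibre would be in the image of the countable set
`K Δ_{g^*(f)}` (`ZOSub.exists_of_isPullback`), and `[0,1]` would be countable. -/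

/-- The open boxes over a map between countable 01-substitution sets are countably many. -/
theorem OpenBox.countable {𝔸 : Type} [Countable 𝔸] {Z Y : ZOSub.{v} 𝔸} [Countable Z] [Countable Y]
    (e : Bool) (p : Z ⟶ Y) : Countable (OpenBox e p) := by
  classical
  -- The function space `𝔸 → Bool → Option Z` is in general uncountable, so `u` is encoded by its
  -- finite graph over `A × 2`. The missing face `(a, e)` enters the graph with the value `none`.
  let F : OpenBox e p → Finset 𝔸 × 𝔸 × Finset (𝔸 × Bool × Option Z) × Y := fun b =>
    (b.A, b.a, (b.A ×ˢ Finset.univ).image fun q : 𝔸 × Bool => (q.1, q.2, b.u q.1 q.2), b.y)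
  refine Function.Injective.countable (f := F) fun b b' h => ?_
  simp only [F, Prod.mk.injEq] at h
  obtain ⟨hA, ha, hu, hy⟩ := h
  refine OpenBox.ext hA ha (funext fun c => funext fun i => ?_) hy
  by_cases hc : c ∈ b.A
  -- The first two entries of a triple determine its argument, so the triple at `(c, i)` found in
  -- the graph of `b'.u` is the one of `b'` at `(c, i)`.
  · have hmem : (c, i, b.u c i) ∈
        (b.A ×ˢ Finset.univ).image fun q : 𝔸 × Bool => (q.1, q.2, b.u q.1 q.2) :=
      Finset.mem_image.2 ⟨(c, i), by simp [hc], rfl⟩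
    rw [hu] at hmem
    obtain ⟨⟨d, j⟩, -, hd⟩ := Finset.mem_image.1 hmem
    simp only [Prod.mk.injEq] at hd
    obtain ⟨rfl, rfl, hd⟩ := hd
    exact hd.symm
  -- Outside `A`, which the graph does not see, both functions have the default value `none`.
  · have h1 : b.u c i = none := by
      rw [← Option.not_isSome_iff_eq_none, b.dom]
      exact fun h => hc h.1
    have h2 : b'.u c i = none := by
      rw [← Option.not_isSome_iff_eq_none, b'.dom]
      exact fun h => hc (hA ▸ h.1)
    rw [h1, h2]

section Countability

variable {𝔸 : Type} [DecidableEq 𝔸] [Infinite 𝔸] [Countable 𝔸] {X Z Y : ZOSub.{v} 𝔸}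
  [Countable X] [Countable Y]

theorem Step.countable [Countable Z] (p : Z ⟶ Y) : Countable (Step X p) := by
  have := OpenBox.countable (p := p)
  have : ∀ e, Countable (Comp e p) := fun e => inferInstanceAs (Countable (Quotient _))
  let F : X ⊕ (Σ e, OpenBox e p) ⊕ (Σ e, Comp e p) → Step X p :=
    Sum.elim Step.base (Sum.elim (fun q => Step.fill q.1 q.2) fun q => Step.comp q.1 q.2)
  refine Function.Surjective.countable (f := F) fun s => ?_
  cases s with
  | base x => exact ⟨Sum.inl x, rfl⟩
  | fill e b => exact ⟨Sum.inr (Sum.inl ⟨e, b⟩), rfl⟩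
  | comp e q => exact ⟨Sum.inr (Sum.inr ⟨e, q⟩), rfl⟩

/-- Each stage is built from `X` and from boxes over the previous stage, whose faces lie in that
stage and whose bases lie in `Y`; countability thus passes from stage to stage. -/
theorem stage_countable (f : X ⟶ Y) (n : ℕ) : Countable (stage f n).Z := by
  induction n with
  | zero => assumption
  | succ n ih => exact Step.countable (stage f n).p

/-- Every element of the colimit has a representative at some finite stage, so the colimit is a
quotient of a countable disjoint union of countable sets. -/
theorem KObj_countable (f : X ⟶ Y) : Countable (KObj f) := by
  have : ∀ n, Countable ((stageFunctor f).obj n) := stage_countable f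
  refine Function.Surjective.countable
    (f := fun q : Σ n, (stageFunctor f).obj n => seqColim.incl (stageFunctor f) q.1 q.2) fun z => ?_
  obtain ⟨q, rfl⟩ := Quotient.exists_rep z
  exact ⟨q, rfl⟩

end Countability

/-! ### An invariant of the elements of `K f` -/

section OppositeEnd

variable {𝔸 : Type} [DecidableEq 𝔸] [Infinite 𝔸] {X Z Y : ZOSub.{v} 𝔸}

/-- The function to `Y` that sends `x` to `f x`, `(u, y)` to `y`, and the composite `⟨a⟩(u, y)` of
an `e`-open box to the end `y(a := 1 - e)` of `y` opposite to its projection. -/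
def Step.oppositeEnd (f : X ⟶ Y) {p : Z ⟶ Y} (s : Step X p) : Y :=
  match s with
  | base x => f x
  | fill _ b => b.y
  | comp e q => q.lift (fun b => Y.sub b.y b.a (!e)) fun b k hk hkb => by
      -- Both `k` and `b.a` are fresh for `y(a := 1 - e)`: `k` because it is fresh for `y` and
      -- differs from `a`, and `a` because it has been substituted. Their transposition therefore
      -- fixes this element, and renaming `a` to `k` does not change the value.
      have h := Y.smul_sub (FinPerm.swap k b.a) b.y b.a (!e)
      rw [Fresh.swap_smul_eq (ZOSub.fresh_sub_of_fresh (!e) (OpenBox.fresh_y hkb) hk)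
        (Y.fresh_sub _ _ _)] at h
      rw [OpenBox.smul_y, OpenBox.smul_a, ← h]

/-- `Step.oppositeEnd` on all stages; on stage `0` it is `f`. -/
def stageOppositeEnd (f : X ⟶ Y) : (n : ℕ) → (stage f n).Z → Y
  | 0 => fun x => f x
  | _ + 1 => Step.oppositeEnd f

/-- The map to the next stage changes only the faces `u` of a box. It keeps `a`, `e`, `y` and the
elements of `X`, and nothing else enters the opposite end. Only a function of underlying sets is
needed: at `(c, i) = (a, e)` substitution turns `(u, y)` into `⟨a⟩(u, y)`, with opposite end `y(a :=
1 - e)` instead of `y(a := e)`, so compatibility with substitution is not to be expected. -/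
theorem stageOppositeEnd_toNext (f : X ⟶ Y) (n : ℕ) (z : (stage f n).Z) :
    stageOppositeEnd f (n + 1) ((stage f n).toNext z) = stageOppositeEnd f n z := by
  cases n with
  | zero => rfl
  | succ n =>
    cases z with
    | base x => rfl
    | fill e b => rfl
    | comp e q =>
      induction q using Comp.ind with
      | h b => rfl

theorem stageOppositeEnd_map (f : X ⟶ Y) {m n : ℕ} (h : m ≤ n) (z : (stageFunctor f).obj m) :
    stageOppositeEnd f n ((stageFunctor f).map (homOfLE h) z) = stageOppositeEnd f m z := by
  induction n, h using Nat.le_induction with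
  | base => exact congrArg (stageOppositeEnd f m) (DirectedSystem.map_self
      (f := fun _ _ h => ⇑((stageFunctor f).map (homOfLE h))) z)
  | succ n hn ih =>
    refine Eq.trans (congrArg (stageOppositeEnd f (n + 1)) ?_)
      ((stageOppositeEnd_toNext f n ((stageFunctor f).map (homOfLE hn) z)).trans ih)
    -- The transition map from `m` to `n + 1` is factored through stage `n`; its last factor is
    -- `toNext`.
    rw [← DirectedSystem.map_map (f := fun _ _ h => ⇑((stageFunctor f).map (homOfLE h)))
      hn n.le_succ z]
    exact congrArg (fun k : (stage f n).Z ⟶ (stage f (n + 1)).Z =>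
      k ((stageFunctor f).map (homOfLE hn) z))
      (Functor.ofSequence_map_homOfLE_succ (X := fun n => (stage f n).Z)
        (fun n => (stage f n).toNext) n)

/-- Two elements of a stage that become equal in the colimit are already equal at some later stage,
and the transition maps preserve the opposite end. This is how elements of `K f` are told apart. -/
theorem stageOppositeEnd_eq_of_incl_eq (f : X ⟶ Y) {n : ℕ} {z z' : (stageFunctor f).obj n}
    (h : seqColim.incl (stageFunctor f) n z = seqColim.incl (stageFunctor f) n z') :
    stageOppositeEnd f n z = stageOppositeEnd f n z' := by
  obtain ⟨m, hm, hm', h⟩ := Quotient.exact h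
  rw [← stageOppositeEnd_map f hm z, ← stageOppositeEnd_map f hm z']
  exact congrArg (stageOppositeEnd f m) h

end OppositeEnd

/-! ### Identities and pullbacks -/

/-- The base `y` of a box over the identity is its only possible filler. It has the prescribed faces
because `u(b, i)` lies over `y(b := i)`, and taking the base commutes with permutations and
substitutions by definition. -/
theorem isKanFibration_id {𝔸 : Type} [DecidableEq 𝔸] [Infinite 𝔸] (X : ZOSub.{v} 𝔸) :
    IsKanFibration (𝟙 X) := fun _ =>
  ⟨fun b => b.y, fun b => ⟨fun c i z hz => (b.lies_over c i z hz).symm, rfl⟩,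
    fun _ _ => rfl, fun _ _ _ _ => rfl⟩

/-- In a pullback square, an element of `C` over the image of `B` comes from the corner. -/
theorem ZOSub.exists_of_isPullback {𝔸 : Type} {P B C D : ZOSub.{v} 𝔸} {k : P ⟶ C} {r : P ⟶ B}
    {r' : C ⟶ D} {g : B ⟶ D} (h : IsPullback k r r' g) {c : C} {b : B} (hcb : r' c = g b) :
    ∃ x : P, k x = c :=
  -- The universal property is tested on the fibre product of underlying sets, which has `(c, b)` as
  -- an element; its image under the lift is the required `x`.
  ⟨h.lift (fibreFst r' g) (fibreSnd r' g) (fibre_condition r' g) ⟨(c, b), hcb⟩,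
    congrArg (fun m : fibreProd r' g ⟶ C => m ⟨(c, b), hcb⟩)
      (h.lift_fst (fibreFst r' g) (fibreSnd r' g) (fibre_condition r' g))⟩

/-! ### Composites in the path object of the nerve of the interval -/

/-- The element `r ↦ t · r(0)` of the nerve of the interval. -/
def scaledCoord (t : unitInterval) : metricNerve unitInterval :=
  ⟨⟨fun r => t * r 0, CompactSpace.uniformContinuous_of_continuous (by fun_prop)⟩,
    {0}, CubeFun.supports_of_agree fun r r' h => by
      change t * r 0 = t * r' 0
      rw [h 0 (by simp)]⟩

/-- This end of the path does not depend on `t`, which places all the composites in one fibre of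
`ρ`. The end at `1` is the constant `t` and distinguishes them. -/
theorem scaledCoord_sub_false (t : unitInterval) :
    (metricNerve unitInterval).sub (scaledCoord t) 0 false = nervePoint 0 PUnit.unit := by
  refine Subtype.ext (CubeFun.ext (funext fun r => ?_))
  change t * Function.update r 0 (CubeFun.endpoint false) 0 = 0
  simp [CubeFun.endpoint]

theorem scaledCoord_sub_true (t : unitInterval) :
    (metricNerve unitInterval).sub (scaledCoord t) 0 true = nervePoint t PUnit.unit := by
  refine Subtype.ext (CubeFun.ext (funext fun r => ?_))
  change t * Function.update r 0 (CubeFun.endpoint true) 0 = t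
  simp [CubeFun.endpoint]

/-- The `0`-open `({0}, 0)`-box over the diagonal of the identity whose base is the path
`r ↦ t · r(0)` from `0` to `t`. -/
def scaledBox (t : unitInterval) : OpenBox false (diag (𝟙 (metricNerve unitInterval))) where
  A := {0}
  a := 0
  -- With `A = {0}`, `a = 0` and `e = 0` the domain of `u` is the single point `(0, 1)`. The value
  -- there is forced: it must be sent by the diagonal to the end at `1` of the base.
  u c i := if c = 0 ∧ i = true then some (nervePoint t PUnit.unit) else none
  y := diag (𝟙 (metricNerve unitInterval)) (scaledCoord t)
  mem := by simp
  dom c i := by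
    by_cases hc : c = 0 <;> cases i <;> simp [hc]
  fresh c i z hz := by
    simp only [Option.ite_none_right_eq_some, Option.some.injEq] at hz
    rw [← hz.2]
    exact ⟨∅, fun _ _ => rfl, by simp⟩
  adj c c' i i' z z' hcc hz hz' := by
    -- The box has faces in one direction only, so no two faces with different names have to be
    -- compared.
    simp only [Option.ite_none_right_eq_some] at hz hz'
    exact absurd (hz.1.1.trans hz'.1.1.symm) hcc
  lies_over c i z hz := by
    simp only [Option.ite_none_right_eq_some, Option.some.injEq] at hz
    obtain ⟨⟨rfl, rfl⟩, rfl⟩ := hz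
    rw [← ZOSub.hom_sub, scaledCoord_sub_true]

/-- The composite of `scaledBox t`, an element of the path object over the constant `0`. -/
noncomputable def scaledComp (t : unitInterval) : KObj (diag (𝟙 (metricNerve unitInterval))) :=
  seqColim.incl (stageFunctor _) 1 (Step.comp false (Comp.mk (scaledBox t)))

/-- The projection of the composite is `y(a := e)` with `a = 0` and `e = 0`, the end of the path at
the constant `0`. -/
theorem rho_scaledComp (t : unitInterval) :
    rho (diag (𝟙 (metricNerve unitInterval))) (scaledComp t) =
      diag (𝟙 (metricNerve unitInterval)) (nervePoint 0 PUnit.unit) := by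
  rw [← scaledCoord_sub_false t, ZOSub.hom_sub]
  rfl

theorem scaledComp_injective : Function.Injective scaledComp := by
  intro t t' h
  -- The opposite end of `scaledBox t` is its base at `0 := 1`, as `e = 0`.
  have h1 : (fibreProd _ _).sub (diag (𝟙 (metricNerve unitInterval)) (scaledCoord t)) 0 true =
      (fibreProd _ _).sub (diag (𝟙 (metricNerve unitInterval)) (scaledCoord t')) 0 true :=
    stageOppositeEnd_eq_of_incl_eq (diag (𝟙 (metricNerve unitInterval))) h
  rw [← ZOSub.hom_sub, ← ZOSub.hom_sub, scaledCoord_sub_true, scaledCoord_sub_true] at h1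
  -- The opposite ends are the diagonal images of the constant functions `t` and `t'`. The parameter
  -- is read off from the first component, at an arbitrary point of the cube.
  exact congrArg (fun q => q.1.1.1.toFun fun _ => 0) h1

/-! ### A countable path object against an uncountable fibre. -/

/-- The identity `f` of the nerve `N([0,1])` is a Kan fibration, and for the map `g : 1 ⟶ N([0,1])`
that picks `0` no map `K Δ_{g^*(f)} ⟶ K Δ_f` is the top side of a pullback square with the sides
`ρ` over the canonical map `g^*(X) ×_1 g^*(X) ⟶ X ×_X X`. -/
theorem mainTheorem4 :
    IsKanFibration (𝟙 (metricNerve unitInterval)) ∧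
    ¬ ∃ k : KObj (diag (baseChange (𝟙 (metricNerve unitInterval)) (nervePoint (0 : unitInterval)))) ⟶
          KObj (diag (𝟙 (metricNerve unitInterval))),
        IsPullback k
          (rho (diag (baseChange (𝟙 (metricNerve unitInterval)) (nervePoint (0 : unitInterval)))))
          (rho (diag (𝟙 (metricNerve unitInterval))))
          (baseChangeMap (𝟙 (metricNerve unitInterval)) (nervePoint (0 : unitInterval))) := by
  refine ⟨isKanFibration_id _, ?_⟩
  rintro ⟨k, hk⟩
  -- An element of `g^*(X)` is a pair whose first component equals the constant function `0`, since
  -- `f` is the identity.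
  have hX : Subsingleton
      (fibreProd (𝟙 (metricNerve unitInterval)) (nervePoint (0 : unitInterval))) :=
    ⟨fun q q' => Subtype.ext (Prod.ext (q.2.trans q'.2.symm) rfl)⟩
  have hY : Subsingleton
      (fibreProd (baseChange (𝟙 (metricNerve unitInterval)) (nervePoint (0 : unitInterval)))
        (baseChange (𝟙 (metricNerve unitInterval)) (nervePoint (0 : unitInterval)))) :=
    ⟨fun q q' => Subtype.ext (Prod.ext (Subsingleton.elim _ _) (Subsingleton.elim _ _))⟩
  have hK := KObj_countable
    (diag (baseChange (𝟙 (metricNerve unitInterval)) (nervePoint (0 : unitInterval))))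
  let x₀ : fibreProd (𝟙 (metricNerve unitInterval)) (nervePoint (0 : unitInterval)) :=
    ⟨(nervePoint 0 PUnit.unit, PUnit.unit), rfl⟩
  -- The canonical map sends the diagonal image of `x₀` to the pair of constant functions `0`, over
  -- which all the composites lie.
  have hsub : Set.range scaledComp ⊆ Set.range k := by
    rintro _ ⟨t, rfl⟩
    exact ZOSub.exists_of_isPullback hk (b := diag (baseChange _ _) x₀) (rho_scaledComp t)
  -- The image of `k` is countable by `hK`, whereas `scaledComp` embeds `[0,1]` into it.
  have := ((Set.countable_range k).mono hsub).to_subtype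
  have hI : Countable unitInterval := (Equiv.ofInjective _ scaledComp_injective).countable_iff.2 this
  exact not_le.2 zero_lt_one (Cardinal.Real.Icc_countable_iff.1 (Set.countable_coe_iff.1 hI))
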